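/- Let $M$ be a smooth ($C^\infty$) finite-dimensional manifold and let $p,q\in\mathbb{R}$. A metallic Riemannian structure with parameters $p,q$ on $M$ is a pair $(J,g)$ of a smooth endomorphism field $J$ of $TM$ with $J^2=pJ+qI$ and a smooth Riemannian metric $g$ with $g(JX,Y)=g(X,JY)$; $J$ is called integrable if its Nijenhuis tensor $N_J(X,Y)=[JX,JY]-J[JX,Y]-J[X,JY]+J^2[X,Y]$ vanishes for all smooth vector fields $X,Y$. Let $(J,g)$ be such a structure on $M$, let $\nabla$ be the Levi-Civita connection of $g$, and suppose that $(M,J,g)$ is locally metallic, i.e. $\nabla J=0$, and flat, i.e. the curvature tensor $R(X,Y)Z=\nabla_X\nabla_YZ-\nabla_Y\nabla_XZ-\nabla_{[X,Y]}Z$ vanishes. On $TM\oplus T^*M$ put $\hat J_m(X+\alpha)=JX+J^*\alpha$, where $J^*\alpha=\alpha\circ J$, and $\hat g(X+\alpha,Y+\beta)=g(X,Y)+g(\sharp_g\alpha,\sharp_g\beta)$, where $\sharp_g:T^*M\to TM$ is the inverse of $X\mapsto g(X,\cdot)$. For $a\in TM$ over $x\in M$ let $\Psi^\nabla_a:T_xM\oplus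 T_x^*M\to T_a(TM)$ be the linear isomorphism $\Psi^\nabla_a(X+\alpha)=X^H_a+\chi_a(\sharp_g\alpha)$, where $X^H_a$ is the horizontal lift of $X$ to $a$ with respect to $\nabla$ and $\chi_a$ is the standard identification of $T_xM$ with the vertical subspace of $T_a(TM)$. Define $\bar J_m:=\Psi^\nabla\circ\hat J_m\circ(\Psi^\nabla)^{-1}$ and $\bar g:=((\Psi^\nabla)^{-1})^*\hat g$ on $TM$. Then $(\bar J_m,\bar g)$ is an integrable metallic Riemannian structure on the manifold $TM$: $\bar J_m$ is a smooth endomorphism field of $T(TM)$ with $\bar J_m^2=p\bar J_m+qI$, $\bar g$ is a smooth Riemannian metric on $TM$ with $\bar g(\bar J_mA,B)=\bar g(A,\bar J_mB)$, and $N_{\bar J_m}=0$. -/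

import Mathlib

open Bundle Manifold VectorField
open scoped ContDiff

noncomputable section

namespace MetallicGeometry

section Basic

variable {E : Type*} [NormedAddCommGroup E] [NormedSpace ℝ E]
  {H : Type*} [TopologicalSpace H] (I : ModelWithCorners ℝ E H)
  {M : Type*} [TopologicalSpace M] [ChartedSpace H M]

/-- A field of endomorphisms of the tangent spaces of `M`. -/
abbrev EndField (M : Type*) [TopologicalSpace M] [ChartedSpace H M] :=
  (x : M) → TangentSpace I x →L[ℝ] TangentSpace I x

variable {I}

/-- The value at `x` of the Nijenhuis tensor field of `J` on the vector fields `X`, `Y`: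
`[JX, JY] - J[JX, Y] - J[X, JY] + J²[X, Y]`. -/
def nijenhuis (J : EndField I M) (X Y : (x : M) → TangentSpace I x) (x : M) :
    TangentSpace I x :=
  mlieBracket I (fun y ↦ J y (X y)) (fun y ↦ J y (Y y)) x
    - J x (mlieBracket I (fun y ↦ J y (X y)) Y x)
    - J x (mlieBracket I X (fun y ↦ J y (Y y)) x)
    + J x (J x (mlieBracket I X Y x))

variable [IsManifold I ∞ M]

/-- `X` is a vector field on `M` that is smooth at `x`. -/
def SmoothFieldAt (X : (x : M) → TangentSpace I x) (x : M) : Prop :=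
  ContMDiffAt I I.tangent ∞ (fun y ↦ (⟨y, X y⟩ : TangentBundle I M)) x

/-- `J` is integrable: its Nijenhuis tensor field vanishes on (locally defined) smooth vector
fields, at every point. -/
def IsIntegrable (J : EndField I M) : Prop :=
  ∀ (x : M) (X Y : (x : M) → TangentSpace I x),
    SmoothFieldAt X x → SmoothFieldAt Y x → nijenhuis J X Y x = 0

/-- `J` is a smooth field of endomorphisms of `TM`, that is, a smooth section of `Hom(TM, TM)`. -/
def IsSmoothEndField (J : EndField I M) : Prop :=
  ContMDiff I (I.prod 𝓘(ℝ, E →L[ℝ] E)) ∞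
    (fun x ↦ TotalSpace.mk' (E →L[ℝ] E)
      (E := fun x : M ↦ TangentSpace I x →L[ℝ] TangentSpace I x) x (J x))

/-- `J` is a metallic structure on `M` with parameters `p`, `q`: a smooth field of endomorphisms
of `TM` with `J² = p J + q`. -/
structure IsMetallic (p q : ℝ) (J : EndField I M) : Prop where
  smooth : IsSmoothEndField J
  sq : ∀ (x : M) (v : TangentSpace I x), J x (J x v) = p • J x v + q • v

variable (I M) in
/-- Smooth Riemannian metrics on `M`. -/
abbrev SmoothMetric := ContMDiffRiemannianMetric I ∞ E (fun x : M ↦ TangentSpace I x)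

/-- `(J, g)` is a metallic Riemannian structure on `M`: `J` is a metallic structure and it is
`g`-symmetric. -/
structure IsMetallicRiemannian (p q : ℝ) (J : EndField I M) (g : SmoothMetric I M) : Prop where
  metallic : IsMetallic p q J
  compatible : ∀ (x : M) (v w : TangentSpace I x), g.inner x (J x v) w = g.inner x v (J x w)

end Basic

section Connection

variable {E : Type*} [NormedAddCommGroup E] [NormedSpace ℝ E]
  {H : Type*} [TopologicalSpace H] {I : ModelWithCorners ℝ E H}
  {M : Type*} [TopologicalSpace M] [ChartedSpace H M] [IsManifold I ∞ M]

variable (I M) in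
/-- Linear connections on `M`. In Mathlib's convention `cov Y x (X x)` is `(∇_X Y)(x)`. -/
abbrev Connection := CovariantDerivative I E (fun x : M ↦ TangentSpace I x)

/-- `cov` is the Levi-Civita connection of `g`: it is torsion-free and compatible with
`g`, that is, `v (g(Y, Z)) = g(∇_v Y, Z) + g(Y, ∇_v Z)`. -/
def IsLeviCivita [FiniteDimensional ℝ E] (g : SmoothMetric I M) (cov : Connection I M) : Prop :=
  haveI : CompleteSpace E := FiniteDimensional.complete ℝ E
  cov.torsion = 0 ∧
    ∀ (x : M) (v : TangentSpace I x) (Y Z : (x : M) → TangentSpace I x),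
      SmoothFieldAt Y x → SmoothFieldAt Z x →
        mvfderiv I (fun y ↦ g.inner y (Y y) (Z y)) x v =
          g.inner x (cov Y x v) (Z x) + g.inner x (Y x) (cov Z x v)

/-- The curvature `R(X, Y)Z = ∇_X ∇_Y Z - ∇_Y ∇_X Z - ∇_[X, Y] Z` at `x`. -/
def curvature (cov : Connection I M) (X Y Z : (x : M) → TangentSpace I x) (x : M) :
    TangentSpace I x :=
  cov (fun y ↦ cov Z y (Y y)) x (X x) - cov (fun y ↦ cov Z y (X y)) x (Y x)
    - cov Z x (mlieBracket I X Y x)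

/-- The connection is flat: its curvature vanishes on (locally defined) smooth vector fields, at
every point. -/
def IsFlat (cov : Connection I M) : Prop :=
  ∀ (x : M) (X Y Z : (x : M) → TangentSpace I x),
    SmoothFieldAt X x → SmoothFieldAt Y x → SmoothFieldAt Z x → curvature cov X Y Z x = 0

/-- `∇ J = 0`, that is, `∇_v (J Y) - J (∇_v Y) = 0` for all tangent vectors `v` at `x` and all
(locally defined) smooth vector fields `Y`. -/
def IsParallel (cov : Connection I M) (J : EndField I M) : Prop :=
  ∀ (x : M) (v : TangentSpace I x) (Y : (x : M) → TangentSpace I x),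
    SmoothFieldAt Y x → cov (fun y ↦ J y (Y y)) x v - J x (cov Y x v) = 0

/-- `(M, J, g)` is a flat locally metallic Riemannian manifold whose Levi-Civita connection
is `cov`. -/
structure IsFlatLocallyMetallic [FiniteDimensional ℝ E] (p q : ℝ) (J : EndField I M)
    (g : SmoothMetric I M) (cov : Connection I M) : Prop where
  metallicRiemannian : IsMetallicRiemannian p q J g
  leviCivita : IsLeviCivita g cov
  parallel : IsParallel cov J
  flat : IsFlat cov

end Connection

section GeneralizedTangentBundle

variable {E : Type*} [NormedAddCommGroup E] [NormedSpace ℝ E]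
  {H : Type*} [TopologicalSpace H] {I : ModelWithCorners ℝ E H}
  {M : Type*} [TopologicalSpace M] [ChartedSpace H M] [IsManifold I ∞ M]

variable (I) in
/-- The cotangent space of `M` at `x`. -/
abbrev Cotangent (x : M) := TangentSpace I x →L[ℝ] ℝ

variable (I) in
/-- The fibre at `x` of the generalized tangent bundle `TM ⊕ T*M`. -/
abbrev GenTangent (x : M) := TangentSpace I x × Cotangent I x

/-- `♭_g : T_x M → T_x* M`, `v ↦ g(v, ·)`. -/
def flat (g : SmoothMetric I M) (x : M) : TangentSpace I x →L[ℝ] Cotangent I x := g.inner x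

/-- `♯_g : T_x* M → T_x M`, the inverse of `♭_g`. -/
def sharp (g : SmoothMetric I M) (x : M) : Cotangent I x →L[ℝ] TangentSpace I x := (flat g x).inverse

/-- `♭_g` is invertible, so `sharp` is its actual inverse. -/
theorem flat_isInvertible [FiniteDimensional ℝ E] (g : SmoothMetric I M) (x : M) :
    (flat g x).IsInvertible := by
  have hinj : Function.Injective (flat g x) := by
    rw [injective_iff_map_eq_zero]
    intro v hv
    by_contra hne
    have := g.pos x v hne
    have h2 : g.inner x v v = 0 := congrArg (fun l : TangentSpace I x →L[ℝ] ℝ ↦ l v) hv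
    linarith
  let f : E →L[ℝ] (E →L[ℝ] ℝ) := flat g x
  have hr : Module.finrank ℝ E = Module.finrank ℝ (E →L[ℝ] ℝ) := by
    rw [← (LinearMap.toContinuousLinearMap (𝕜 := ℝ) (E := E) (F' := ℝ)).finrank_eq,
      Module.finrank_linearMap_self]
  let e := LinearEquiv.ofInjectiveOfFinrankEq f.toLinearMap hinj hr
  exact ⟨e.toContinuousLinearEquiv, by ext v; rfl⟩

/-- The dual endomorphism `J* α = α ∘ J`. -/
def dualEnd (J : EndField I M) (x : M) : Cotangent I x →L[ℝ] Cotangent I x :=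
  ContinuousLinearMap.precomp ℝ (J x)

/-- The generalized metallic structure `Ĵ_m (X + α) = J X + J* α` on `TM ⊕ T*M`. -/
def genMetallic (J : EndField I M) (x : M) : GenTangent I x →L[ℝ] GenTangent I x :=
  (J x).prodMap (dualEnd J x)

/-- The metric `ĝ (X + α, Y + β) = g(X, Y) + g(♯ α, ♯ β)` on `TM ⊕ T*M`. -/
def genMetric (g : SmoothMetric I M) (x : M) (s t : GenTangent I x) : ℝ :=
  g.inner x s.1 t.1 + g.inner x (sharp g x s.2) (sharp g x t.2)

end GeneralizedTangentBundle

section TangentBundleLift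

variable {E : Type*} [NormedAddCommGroup E] [NormedSpace ℝ E]
  {H : Type*} [TopologicalSpace H] {I : ModelWithCorners ℝ E H}
  {M : Type*} [TopologicalSpace M] [ChartedSpace H M] [IsManifold I ∞ M]

/-- The standard identification `χ_a` of `T_{π a} M` with the vertical subspace of `T_a (TM)`:
the derivative at `a` of the inclusion into `TM` of its fibre through `a`. -/
def vertical (a : TangentBundle I M) : TangentSpace I a.proj →L[ℝ] TangentSpace I.tangent a :=
  mfderiv 𝓘(ℝ, E) I.tangent (fun v : E ↦ (⟨a.proj, v⟩ : TangentBundle I M)) a.snd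

/-- The horizontal lift `X ↦ X^H_a` from `T_{π a} M` to `T_a (TM)`: for a section `σ` of `TM`
with `σ (π a) = a`, it is `dσ (X) - χ_a (∇_X σ)`. -/
def horizontal (cov : Connection I M) (a : TangentBundle I M) :
    TangentSpace I a.proj →L[ℝ] TangentSpace I.tangent a :=
  let σ : (x : M) → TangentSpace I x := FiberBundle.extend E a.snd
  let dσ : TangentSpace I a.proj →L[ℝ] TangentSpace I.tangent a :=
    mfderiv I I.tangent (fun x ↦ (⟨x, σ x⟩ : TangentBundle I M)) a.proj
  dσ - vertical a ∘L cov σ a.proj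

/-- The morphism `Ψ^∇ (X + α) = X^H_a + χ_a (♯_g α)` at `a ∈ TM`. -/
def Psi (g : SmoothMetric I M) (cov : Connection I M) (a : TangentBundle I M) :
    GenTangent I a.proj →L[ℝ] TangentSpace I.tangent a :=
  (horizontal cov a).coprod (vertical a ∘L sharp g a.proj)

theorem smooth_fibreIncl (x : M) :
    ContMDiff 𝓘(ℝ, E) I.tangent ∞ (fun v : E ↦ (⟨x, v⟩ : TangentBundle I M)) := by
  intro v
  rw [Bundle.contMDiffAt_totalSpace]
  refine ⟨contMDiffAt_const, ?_⟩
  have : (fun v : E ↦ (trivializationAt E (TangentSpace I : M → Type _) x (⟨x, v⟩ : TangentBundle I M)).2) = id := by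
    ext v
    simp [TangentBundle.trivializationAt_apply]
    exact (tangentBundleCore I M).coordChange_self (achart H x) x (mem_chart_source H x) v
  simp only [this]
  exact contMDiffAt_id

/-- In the model coordinates of `T_a (TM)`, the vertical vector `χ_a v` is `(0, v)`. -/
theorem vertical_eq (a : TangentBundle I M) (v : E) : vertical a v = ((0, v) : E × E) := by
  obtain ⟨x, w⟩ := a
  have hd := ((smooth_fibreIncl (I := I) x).mdifferentiable (by simp) (w : E)).mfderiv
  have : writtenInExtChartAt 𝓘(ℝ, E) I.tangent (M := E) w (fun v : E ↦ (⟨x, v⟩ : TangentBundle I M)) =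
      fun v ↦ (extChartAt I x x, v) := by
    ext v
    · simp [writtenInExtChartAt, mfld_simps]
    · simp [writtenInExtChartAt, mfld_simps]
      exact (tangentBundleCore I M).coordChange_self (achart H x) x (mem_chart_source H x) v
  rw [this] at hd
  have h2 : fderivWithin ℝ (fun v : E ↦ ((extChartAt I x x, v) : E × E)) (Set.range 𝓘(ℝ, E))
      (extChartAt 𝓘(ℝ, E) (M := E) w w) = ContinuousLinearMap.inr ℝ E E := by
    simp only [modelWithCornersSelf_coe, Set.range_id, fderivWithin_univ]
    exact ((hasFDerivAt_const _ _).prodMk (hasFDerivAt_id _)).fderiv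
  rw [h2] at hd
  exact congrArg (fun l : E →L[ℝ] E × E ↦ l v) hd

theorem mdifferentiableAt_proj (b : TangentBundle I M) :
    MDifferentiableAt I.tangent I (fun b : TangentBundle I M ↦ b.proj) b :=
  (Bundle.contMDiff_proj (n := 1) (IB := I) (TangentSpace I : M → Type _)).mdifferentiable
    (by simp) b

/-- Vertical vectors are killed by `π_*`. -/
theorem mfderiv_proj_vertical (a : TangentBundle I M) (v : TangentSpace I a.proj) :
    mfderiv I.tangent I (fun b : TangentBundle I M ↦ b.proj) a (vertical a v) = 0 := by
  have := HasMFDerivAt.comp (I := 𝓘(ℝ, E)) (I' := I.tangent) (I'' := I) (M := E)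
    (f := fun v : E ↦ (⟨a.proj, v⟩ : TangentBundle I M)) a.snd
    (mdifferentiableAt_proj (⟨a.proj, a.snd⟩ : TangentBundle I M)).hasMFDerivAt
    ((smooth_fibreIncl (I := I) a.proj).mdifferentiable (by simp) (a.snd : E)).hasMFDerivAt
  have h0 := hasMFDerivAt_const (I := 𝓘(ℝ, E)) (I' := I) (M := E) a.proj a.snd
  exact congrArg (fun l : E →L[ℝ] E ↦ l v) (hasMFDerivAt_unique this h0)

theorem mfderiv_proj_horizontal (cov : Connection I M) (a : TangentBundle I M)
    (X : TangentSpace I a.proj) :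
    mfderiv I.tangent I (fun b : TangentBundle I M ↦ b.proj) a (horizontal cov a X) = X := by
  set P : E × E →L[ℝ] E := mfderiv I.tangent I (fun b : TangentBundle I M ↦ b.proj) a with hP
  have h2 (v : E) : P ((mfderiv I I.tangent
      (fun y ↦ (⟨y, FiberBundle.extend E a.snd y⟩ : TangentBundle I M)) a.proj : E →L[ℝ] E × E) v)
      = v := by
    have hw : (⟨a.proj, FiberBundle.extend E a.snd a.proj⟩ : TangentBundle I M) = a := by simp
    have hPa : HasMFDerivAt I.tangent I (fun b : TangentBundle I M ↦ b.proj)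
        (⟨a.proj, FiberBundle.extend E a.snd a.proj⟩ : TangentBundle I M) P := by
      have := (mdifferentiableAt_proj a).hasMFDerivAt
      rw [← hP] at this
      rw [hw]; exact this
    have := HasMFDerivAt.comp (I := I) (I' := I.tangent) (I'' := I) (M := M)
      (f := fun y ↦ (⟨y, FiberBundle.extend E a.snd y⟩ : TangentBundle I M)) a.proj hPa
      (FiberBundle.mdifferentiableAt_extend I E a.snd).hasMFDerivAt
    have h0 := hasMFDerivAt_id (I := I) a.proj
    exact congrArg (fun l : E →L[ℝ] E ↦ l v) (hasMFDerivAt_unique this h0)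
  have h3 := map_sub P ((mfderiv I I.tangent
      (fun y ↦ (⟨y, FiberBundle.extend E a.snd y⟩ : TangentBundle I M)) a.proj : E →L[ℝ] E × E) X)
      (vertical a (cov (FiberBundle.extend E a.snd) a.proj X))
  exact h3.trans ((congrArg₂ (fun u w : E ↦ u - w) (h2 X) (mfderiv_proj_vertical a _)).trans (sub_zero X))

/-- `Ψ^∇` is an isomorphism on the fibres, so the inverse used below is its actual inverse. -/
theorem Psi_isInvertible [FiniteDimensional ℝ E] (g : SmoothMetric I M) (cov : Connection I M)
    (a : TangentBundle I M) : (Psi g cov a).IsInvertible := by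
  have hinj : Function.Injective (Psi g cov a) := by
    rw [injective_iff_map_eq_zero]
    rintro ⟨X, α⟩ h
    have h' : horizontal cov a X + vertical a (sharp g a.proj α) = 0 := h
    have hX : X = 0 := by
      rw [← mfderiv_proj_horizontal cov a X, eq_neg_of_add_eq_zero_left h', map_neg,
        mfderiv_proj_vertical, neg_zero]
    subst hX
    rw [map_zero, zero_add] at h'
    have h3 : sharp g a.proj α = 0 :=
      congrArg (fun z : E × E ↦ z.2) ((vertical_eq a (sharp g a.proj α)).symm.trans h')
    have h4 : α = 0 := by
      rw [← (flat_isInvertible g a.proj).self_apply_inverse α]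
      exact (congrArg (flat g a.proj) h3).trans (map_zero _)
    rw [h4]; rfl
  let f : (E × (E →L[ℝ] ℝ)) →L[ℝ] (E × E) := Psi g cov a
  have hr : Module.finrank ℝ (E × (E →L[ℝ] ℝ)) = Module.finrank ℝ (E × E) := by
    rw [Module.finrank_prod, Module.finrank_prod,
      ← (LinearMap.toContinuousLinearMap (𝕜 := ℝ) (E := E) (F' := ℝ)).finrank_eq,
      Module.finrank_linearMap_self]
  let e := LinearEquiv.ofInjectiveOfFinrankEq f.toLinearMap hinj hr
  exact ⟨e.toContinuousLinearEquiv, by ext v <;> rfl⟩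

/-- The lifted structure `J̄_m = Ψ^∇ ∘ Ĵ_m ∘ (Ψ^∇)⁻¹` on `TM`. -/
def liftMetallic (J : EndField I M) (g : SmoothMetric I M) (cov : Connection I M) :
    EndField I.tangent (TangentBundle I M) :=
  fun a ↦ Psi g cov a ∘L genMetallic J a.proj ∘L (Psi g cov a).inverse

/-- The lifted metric `ḡ = ((Ψ^∇)⁻¹)^* ĝ` on `TM`. -/
def liftMetric (g : SmoothMetric I M) (cov : Connection I M) (a : TangentBundle I M)
    (A B : TangentSpace I.tangent a) : ℝ :=
  genMetric g a.proj ((Psi g cov a).inverse A) ((Psi g cov a).inverse B)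

end TangentBundleLift

end MetallicGeometry

end

open MetallicGeometry

/-! In the chart of `TM` induced by a chart of `M`, points are pairs (y, v) and the Levi-Civita
connection appears through its Christoffel symbols Γ. The vertical lift of w is (0, w), and the
horizontal lift of X is (X, -Γ(X, v)). Since `J` is `g`-symmetric, `♯_g` carries `J*` to `J`
(`sharp_dualEnd`). The lifted structure therefore acts as `J` on the horizontal and the vertical
part alike, and in coordinates it sends (X, W) to (JX, JW + JΓ(X, v) - Γ(JX, v)). The lifted metric
is the Sasaki metric.

The quadratic relation, the symmetry and the positivity are statements on fibres, carried over from
`TM ⊕ T*M` by the isomorphism Ψ. Smoothness needs Γ to be smooth. This is not part of the notion of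
connection used here; it follows from the Koszul formula (`metricRep_christoffel`,
`contDiffAt_christoffel`).

For integrability, the Nijenhuis tensor of a field of endomorphisms A depends at each point only on
A, its first derivative and the values of the two vector fields (`fibreCoord_nijenhuis`). In a chart
the hypotheses become three identities: Γ is symmetric, dJ(ξ) is the commutator of `J` with Γ(ξ, ·),
and dΓ satisfies the zero curvature equation. Substituting them into the local formula cancels every
term (`nijenhuisModel_liftModel`). Geometrically, on two horizontal lifts the tensor has horizontal
part N_J, which vanishes because ∇ is torsion-free and ∇J = 0; its vertical part is a combination of
R(JX, JY)v, JR(JX, Y)v, JR(X, JY)v and J²R(X, Y)v, which vanishes by flatness. -/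

noncomputable section

namespace MetallicGeometry

/-! ### Tensor fields in the coordinates of a chart -/

section ChartRepresentation

variable {E : Type*} [NormedAddCommGroup E] [NormedSpace ℝ E]
  {H : Type*} [TopologicalSpace H] {I : ModelWithCorners ℝ E H}
  {M : Type*} [TopologicalSpace M] [ChartedSpace H M] [IsManifold I ∞ M]

/-- The coordinates of tangent vectors at `x` in the preferred chart at `x₀`. -/
def fibreCoord (x₀ x : M) : TangentSpace I x →L[ℝ] E :=
  (trivializationAt E (TangentSpace I : M → Type _) x₀).continuousLinearMapAt ℝ x

/-- The tangent vector at `x` with given coordinates in the preferred chart at `x₀`. -/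
def fibreCoordSymm (x₀ x : M) : E →L[ℝ] TangentSpace I x :=
  (trivializationAt E (TangentSpace I : M → Type _) x₀).symmL ℝ x

/-- The expression of a vector field in the preferred chart at `x₀`. -/
def fieldRep (x₀ : M) (X : (x : M) → TangentSpace I x) (y : E) : E :=
  fibreCoord x₀ ((extChartAt I x₀).symm y) (X ((extChartAt I x₀).symm y))

variable {x₀ : M} {y : E}

omit [IsManifold I ∞ M] in
theorem mem_chart_source_of_mem_target (hy : y ∈ (extChartAt I x₀).target) :
    (extChartAt I x₀).symm y ∈ (chartAt H x₀).source := by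
  rw [← extChartAt_source I]
  exact (extChartAt I x₀).map_target hy

theorem mem_baseSet_of_mem_target (hy : y ∈ (extChartAt I x₀).target) :
    (extChartAt I x₀).symm y ∈
      (trivializationAt E (TangentSpace I : M → Type _) x₀).baseSet :=
  mem_chart_source_of_mem_target hy

theorem fibreCoord_fibreCoordSymm {x : M} (hx : x ∈ (chartAt H x₀).source) (v : E) :
    fibreCoord (I := I) x₀ x (fibreCoordSymm x₀ x v) = v :=
  (trivializationAt E (TangentSpace I : M → Type _) x₀).continuousLinearMapAt_symmL hx v

theorem fibreCoordSymm_fibreCoord {x : M} (hx : x ∈ (chartAt H x₀).source) (v : TangentSpace I x) :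
    fibreCoordSymm (I := I) x₀ x (fibreCoord x₀ x v) = v :=
  (trivializationAt E (TangentSpace I : M → Type _) x₀).symmL_continuousLinearMapAt hx v

theorem fibreCoord_eq_snd {x : M} (hx : x ∈ (chartAt H x₀).source) (v : TangentSpace I x) :
    fibreCoord (I := I) x₀ x v =
      (trivializationAt E (TangentSpace I : M → Type _) x₀ ⟨x, v⟩).2 :=
  (trivializationAt E (TangentSpace I : M → Type _) x₀).continuousLinearMapAt_apply_of_mem ℝ hx v

theorem fibreCoord_eq_mfderiv {x : M} (hx : x ∈ (chartAt H x₀).source) :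
    fibreCoord (I := I) x₀ x = mfderiv I 𝓘(ℝ, E) (extChartAt I x₀) x :=
  TangentBundle.continuousLinearMapAt_trivializationAt hx

section Boundaryless

variable [I.Boundaryless]

omit [IsManifold I ∞ M] in
theorem target_mem_nhds (hy : y ∈ (extChartAt I x₀).target) : (extChartAt I x₀).target ∈ nhds y :=
  (isOpen_extChartAt_target x₀).mem_nhds hy

theorem contMDiffAt_extChartAt_symm' (hy : y ∈ (extChartAt I x₀).target) :
    ContMDiffAt 𝓘(ℝ, E) I ∞ (extChartAt I x₀).symm y :=
  (contMDiffOn_extChartAt_symm x₀).contMDiffAt (target_mem_nhds hy)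

theorem mdifferentiableAt_extChartAt_symm' (hy : y ∈ (extChartAt I x₀).target) :
    MDifferentiableAt 𝓘(ℝ, E) I (extChartAt I x₀).symm y :=
  (contMDiffAt_extChartAt_symm' hy).mdifferentiableAt (by simp)

theorem fibreCoordSymm_eq_mfderiv (hy : y ∈ (extChartAt I x₀).target) :
    fibreCoordSymm (I := I) x₀ ((extChartAt I x₀).symm y) =
      mfderiv 𝓘(ℝ, E) I (extChartAt I x₀).symm y := by
  have h := TangentBundle.symmL_trivializationAt (I := I) (mem_chart_source_of_mem_target hy)
  rw [(extChartAt I x₀).right_inv hy, I.range_eq_univ, mfderivWithin_univ] at h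
  exact h

theorem mfderiv_extChartAt_symm_inverse (hy : y ∈ (extChartAt I x₀).target) :
    (mfderiv 𝓘(ℝ, E) I (extChartAt I x₀).symm y).inverse =
      fibreCoord (I := I) x₀ ((extChartAt I x₀).symm y) := by
  have hb := mem_chart_source_of_mem_target hy
  rw [← fibreCoordSymm_eq_mfderiv hy]
  apply ContinuousLinearMap.inverse_eq
  · exact ContinuousLinearMap.ext fun v ↦ fibreCoordSymm_fibreCoord hb v
  · exact ContinuousLinearMap.ext fun v ↦ fibreCoord_fibreCoordSymm (E := E) hb v

theorem mpullback_extChartAt_symm (hy : y ∈ (extChartAt I x₀).target)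
    (X : (x : M) → TangentSpace I x) :
    mpullback 𝓘(ℝ, E) I (extChartAt I x₀).symm X y = fieldRep x₀ X y := by
  rw [mpullback_apply, mfderiv_extChartAt_symm_inverse hy]
  rfl

theorem differentiableAt_comp_extChartAt_symm {F : Type*} [NormedAddCommGroup F]
    [NormedSpace ℝ F] {f : M → F} (hy : y ∈ (extChartAt I x₀).target)
    (hf : MDifferentiableAt I 𝓘(ℝ, F) f ((extChartAt I x₀).symm y)) :
    DifferentiableAt ℝ (fun z ↦ f ((extChartAt I x₀).symm z)) y :=
  mdifferentiableAt_iff_differentiableAt.1 (hf.comp y (mdifferentiableAt_extChartAt_symm' hy))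

theorem contDiffAt_comp_extChartAt_symm {F : Type*} [NormedAddCommGroup F]
    [NormedSpace ℝ F] {f : M → F} (hy : y ∈ (extChartAt I x₀).target)
    (hf : ContMDiffAt I 𝓘(ℝ, F) ∞ f ((extChartAt I x₀).symm y)) :
    ContDiffAt ℝ ∞ (fun z ↦ f ((extChartAt I x₀).symm z)) y :=
  contMDiffAt_iff_contDiffAt.1 (hf.comp y (contMDiffAt_extChartAt_symm' hy))

theorem differentiableAt_fieldRep {X : (x : M) → TangentSpace I x}
    (hy : y ∈ (extChartAt I x₀).target)
    (hX : MDifferentiableAt I I.tangent (fun x ↦ (⟨x, X x⟩ : TangentBundle I M))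
      ((extChartAt I x₀).symm y)) :
    DifferentiableAt ℝ (fieldRep x₀ X) y := by
  have h := (Trivialization.mdifferentiableAt_section_iff I
    (trivializationAt E (TangentSpace I : M → Type _) x₀) X (mem_baseSet_of_mem_target hy)).1 hX
  refine (differentiableAt_comp_extChartAt_symm hy h).congr_of_eventuallyEq ?_
  filter_upwards [target_mem_nhds hy] with z hz
  exact fibreCoord_eq_snd (mem_chart_source_of_mem_target hz) _

/-- The coordinate expression of a field is its pullback by the inverse chart, and pullback commutes
with Lie brackets. -/
theorem fibreCoord_mlieBracket [CompleteSpace E] {X Y : (x : M) → TangentSpace I x}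
    (hy : y ∈ (extChartAt I x₀).target)
    (hX : MDifferentiableAt I I.tangent (fun x ↦ (⟨x, X x⟩ : TangentBundle I M))
      ((extChartAt I x₀).symm y))
    (hY : MDifferentiableAt I I.tangent (fun x ↦ (⟨x, Y x⟩ : TangentBundle I M))
      ((extChartAt I x₀).symm y)) :
    fibreCoord x₀ _ (mlieBracket I X Y ((extChartAt I x₀).symm y)) =
      lieBracket ℝ (fieldRep x₀ X) (fieldRep x₀ Y) y := by
  have : IsManifold I (minSmoothness ℝ 2) M := by
    rw [minSmoothness_of_isRCLikeNormedField]; infer_instance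
  have h := mpullback_mlieBracket (n := ∞) hX hY (contMDiffAt_extChartAt_symm' hy)
    (by rw [minSmoothness_of_isRCLikeNormedField]; exact ENat.LEInfty.out)
  rw [mpullback_extChartAt_symm hy] at h
  have hE (V W : E → E) : mlieBracket 𝓘(ℝ, E) V W y = lieBracket ℝ V W y := by
    have h1 := congrFun (mlieBracketWithin_eq_lieBracketWithin (𝕜 := ℝ) (V := V) (W := W)
      (s := Set.univ)) y
    have h2 := congrFun (mlieBracketWithin_univ (I := 𝓘(ℝ, E)) (V := V) (W := W)) y
    exact h2.symm.trans (h1.trans (congrFun lieBracketWithin_univ y))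
  have hrep (Z : (x : M) → TangentSpace I x) :
      (mpullback 𝓘(ℝ, E) I (extChartAt I x₀).symm Z : E → E) =ᶠ[nhds y] fieldRep x₀ Z := by
    filter_upwards [target_mem_nhds hy] with z hz using mpullback_extChartAt_symm hz Z
  exact h.trans ((hE _ _).trans
    (Filter.EventuallyEq.lieBracket_vectorField_eq (E := E) (hrep X) (hrep Y)))

end Boundaryless

/-- The vector field with constant coordinates in the preferred chart at `x₀`. -/
def coordField (x₀ : M) (w : E) (x : M) : TangentSpace I x := fibreCoordSymm x₀ x w

theorem smoothFieldAt_coordField {x : M} (hx : x ∈ (chartAt H x₀).source) (w : E) :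
    SmoothFieldAt (coordField (I := I) x₀ w) x := by
  rw [SmoothFieldAt, Trivialization.contMDiffAt_section_iff
    (e := trivializationAt E (TangentSpace I : M → Type _) x₀) hx]
  refine (contMDiffAt_const (c := w)).congr_of_eventuallyEq ?_
  filter_upwards [(chartAt H x₀).open_source.mem_nhds hx] with z hz
  rw [← fibreCoord_eq_snd hz, coordField, fibreCoord_fibreCoordSymm hz]

theorem SmoothFieldAt.mdifferentiableAt {X : (x : M) → TangentSpace I x} {x : M}
    (hX : SmoothFieldAt X x) :
    MDifferentiableAt I I.tangent (fun x ↦ (⟨x, X x⟩ : TangentBundle I M)) x :=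
  ContMDiffAt.mdifferentiableAt hX (by simp)

theorem fieldRep_coordField (hy : y ∈ (extChartAt I x₀).target) (w : E) :
    fieldRep x₀ (coordField (I := I) x₀ w) y = w :=
  fibreCoord_fibreCoordSymm (mem_chart_source_of_mem_target hy) w

theorem fieldRep_coordField_eventuallyEq [I.Boundaryless] (hy : y ∈ (extChartAt I x₀).target)
    (w : E) : fieldRep x₀ (coordField (I := I) x₀ w) =ᶠ[nhds y] fun _ ↦ w := by
  filter_upwards [target_mem_nhds hy] with z hz using fieldRep_coordField hz w

/-- The expression of a field of endomorphisms in the preferred chart at `x₀`. -/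
def endRep (x₀ : M) (J : EndField I M) (y : E) : E →L[ℝ] E :=
  fibreCoord x₀ ((extChartAt I x₀).symm y) ∘L J ((extChartAt I x₀).symm y) ∘L
    fibreCoordSymm x₀ ((extChartAt I x₀).symm y)

/-- The expression of a field of bilinear forms in the preferred chart at `x₀`. -/
def bilinRep (x₀ : M) (b : (x : M) → TangentSpace I x →L[ℝ] TangentSpace I x →L[ℝ] ℝ) (y : E) :
    E →L[ℝ] E →L[ℝ] ℝ :=
  ContinuousLinearMap.precomp ℝ (fibreCoordSymm x₀ ((extChartAt I x₀).symm y)) ∘L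
    b ((extChartAt I x₀).symm y) ∘L fibreCoordSymm x₀ ((extChartAt I x₀).symm y)

/-- The expression of a metric in the preferred chart at `x₀`. -/
def metricRep (x₀ : M) (g : SmoothMetric I M) (y : E) : E →L[ℝ] E →L[ℝ] ℝ :=
  bilinRep x₀ g.inner y

theorem fibreCoord_end (hy : y ∈ (extChartAt I x₀).target) (J : EndField I M)
    (v : TangentSpace I ((extChartAt I x₀).symm y)) :
    fibreCoord x₀ _ (J _ v) = endRep x₀ J y (fibreCoord x₀ _ v) := by
  have := fibreCoordSymm_fibreCoord (mem_chart_source_of_mem_target hy) v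
  exact congrArg (fun u ↦ fibreCoord x₀ _ (J _ u)) this.symm

theorem inner_eq_metricRep (hy : y ∈ (extChartAt I x₀).target) (g : SmoothMetric I M)
    (v w : TangentSpace I ((extChartAt I x₀).symm y)) :
    g.inner _ v w = metricRep x₀ g y (fibreCoord x₀ _ v) (fibreCoord x₀ _ w) := by
  have hv := fibreCoordSymm_fibreCoord (mem_chart_source_of_mem_target hy) v
  have hw := fibreCoordSymm_fibreCoord (mem_chart_source_of_mem_target hy) w
  change _ = g.inner ((extChartAt I x₀).symm y) (fibreCoordSymm x₀ _ (fibreCoord x₀ _ v))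
    (fibreCoordSymm x₀ _ (fibreCoord x₀ _ w))
  rw [hv, hw]

theorem contDiffAt_endRep [I.Boundaryless] (hy : y ∈ (extChartAt I x₀).target) {J : EndField I M}
    (hJ : IsSmoothEndField J) : ContDiffAt ℝ ∞ (endRep x₀ J) y := by
  have hb := mem_baseSet_of_mem_target hy
  have h := (Trivialization.contMDiffAt_section_iff
    (e := trivializationAt (E →L[ℝ] E)
      (fun x : M ↦ TangentSpace I x →L[ℝ] TangentSpace I x) x₀)
    (x₀ := (extChartAt I x₀).symm y) (by rw [hom_trivializationAt_baseSet]; exact ⟨hb, hb⟩)).1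
    (hJ ((extChartAt I x₀).symm y))
  simp only [hom_trivializationAt_apply] at h
  exact contDiffAt_comp_extChartAt_symm hy h

/-- Identifies the trivialization of the bundle of bilinear forms, in which smoothness of a metric
is defined, with the explicit coordinate expression used for computation. -/
theorem inCoordinates_eq_bilinRep (hy : y ∈ (extChartAt I x₀).target)
    (b : (x : M) → TangentSpace I x →L[ℝ] TangentSpace I x →L[ℝ] ℝ) :
    ContinuousLinearMap.inCoordinates E (TangentSpace I : M → Type _) (E →L[ℝ] ℝ)
      (fun x ↦ TangentSpace I x →L[ℝ] ℝ) x₀ ((extChartAt I x₀).symm y) x₀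
      ((extChartAt I x₀).symm y) (b _) =
    bilinRep x₀ b y := by
  have hb := mem_baseSet_of_mem_target hy
  ext v w
  rw [inCoordinates_apply_eq₂ (E₃ := fun _ : M ↦ ℝ) hb hb (by simp)]
  change _ = b ((extChartAt I x₀).symm y) (Trivialization.symmL ℝ _ _ v)
    (Trivialization.symmL ℝ _ _ w)
  rw [Trivialization.symmL_apply _ hb, Trivialization.symmL_apply _ hb]
  simp

set_option synthInstance.maxHeartbeats 400000 in
theorem contDiffAt_metricRep [I.Boundaryless] (hy : y ∈ (extChartAt I x₀).target)
    (g : SmoothMetric I M) : ContDiffAt ℝ ∞ (metricRep x₀ g) y := by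
  have hb := mem_baseSet_of_mem_target hy
  have h := (Trivialization.contMDiffAt_section_iff
    (e := trivializationAt (E →L[ℝ] E →L[ℝ] ℝ)
      (fun x : M ↦ TangentSpace I x →L[ℝ] TangentSpace I x →L[ℝ] ℝ) x₀)
    (x₀ := (extChartAt I x₀).symm y)
    (by rw [hom_trivializationAt_baseSet, hom_trivializationAt_baseSet]
        exact ⟨hb, hb, by simp⟩)).1
    (g.contMDiff ((extChartAt I x₀).symm y))
  simp only [hom_trivializationAt_apply] at h
  refine (contDiffAt_comp_extChartAt_symm hy h).congr_of_eventuallyEq ?_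
  filter_upwards [target_mem_nhds hy] with z hz
  exact (inCoordinates_eq_bilinRep hz g.inner).symm

end ChartRepresentation

/-! ### Christoffel symbols -/

section Christoffel

variable {E : Type*} [NormedAddCommGroup E] [NormedSpace ℝ E]
  {H : Type*} [TopologicalSpace H] {I : ModelWithCorners ℝ E H}
  {M : Type*} [TopologicalSpace M] [ChartedSpace H M] [IsManifold I ∞ M] {x₀ : M} {y : E}

theorem fieldRep_add (x₀ : M) (σ τ : (x : M) → TangentSpace I x) :
    fieldRep x₀ (σ + τ) = fieldRep x₀ σ + fieldRep x₀ τ := by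
  funext z
  exact map_add (fibreCoord x₀ ((extChartAt I x₀).symm z)) _ _

theorem fieldRep_smul (x₀ : M) (f : M → ℝ) (σ : (x : M) → TangentSpace I x) :
    fieldRep x₀ (f • σ) = fun z ↦ f ((extChartAt I x₀).symm z) • fieldRep x₀ σ z := by
  funext z
  exact map_smul (fibreCoord x₀ ((extChartAt I x₀).symm z)) _ _

/-- Converse of `differentiableAt_fieldRep`. The curvature computation uses it to show that the
fields ∇_Y Z are differentiable before differentiating them again. -/
theorem mdifferentiableAt_of_fieldRep {σ : (x : M) → TangentSpace I x}
    (hy : y ∈ (extChartAt I x₀).target) (h : DifferentiableAt ℝ (fieldRep x₀ σ) y) :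
    MDifferentiableAt I I.tangent (fun x ↦ (⟨x, σ x⟩ : TangentBundle I M))
      ((extChartAt I x₀).symm y) := by
  have hx := mem_chart_source_of_mem_target hy
  rw [Trivialization.mdifferentiableAt_section_iff I
    (trivializationAt E (TangentSpace I : M → Type _) x₀) σ hx]
  have h1 : MDifferentiableAt 𝓘(ℝ, E) 𝓘(ℝ, E) (fieldRep x₀ σ)
      (extChartAt I x₀ ((extChartAt I x₀).symm y)) := by
    rw [(extChartAt I x₀).right_inv hy]
    exact h.mdifferentiableAt
  refine (h1.comp _ (mdifferentiableAt_extChartAt hx)).congr_of_eventuallyEq ?_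
  filter_upwards [(chartAt H x₀).open_source.mem_nhds hx] with z hz
  rw [Function.comp_apply, fieldRep, (extChartAt I x₀).left_inv (by rwa [extChartAt_source]),
    fibreCoord_eq_snd hz]

/-- The flat connection on the domain of the preferred chart at `x₀` which differentiates the
coordinates of vector fields. -/
def chartConnection (x₀ : M) (σ : (x : M) → TangentSpace I x) (x : M) :
    TangentSpace I x →L[ℝ] TangentSpace I x :=
  fibreCoordSymm x₀ x ∘L fderiv ℝ (fieldRep x₀ σ) (extChartAt I x₀ x) ∘L fibreCoord x₀ x

theorem chartConnection_symm (hy : y ∈ (extChartAt I x₀).target)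
    (σ : (x : M) → TangentSpace I x) (v : TangentSpace I ((extChartAt I x₀).symm y)) :
    chartConnection x₀ σ ((extChartAt I x₀).symm y) v =
      fibreCoordSymm x₀ _ (fderiv ℝ (fieldRep x₀ σ) y (fibreCoord x₀ _ v)) := by
  change fibreCoordSymm x₀ _ (fderiv ℝ (fieldRep x₀ σ) (extChartAt I x₀ ((extChartAt I x₀).symm y))
    (fibreCoord x₀ _ v)) = _
  rw [(extChartAt I x₀).right_inv hy]

variable [I.Boundaryless]

theorem fderiv_comp_extChartAt_symm {F : Type*} [NormedAddCommGroup F] [NormedSpace ℝ F]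
    {f : M → F} (hy : y ∈ (extChartAt I x₀).target)
    (hf : MDifferentiableAt I 𝓘(ℝ, F) f ((extChartAt I x₀).symm y))
    (v : TangentSpace I ((extChartAt I x₀).symm y)) :
    fderiv ℝ (fun z ↦ f ((extChartAt I x₀).symm z)) y (fibreCoord x₀ _ v) =
      mvfderiv I f ((extChartAt I x₀).symm y) v := by
  have h := (hf.hasMFDerivAt.comp y (mdifferentiableAt_extChartAt_symm' hy).hasMFDerivAt)
  rw [← fibreCoordSymm_eq_mfderiv hy] at h
  have h2 : HasFDerivAt (fun z : E ↦ f ((extChartAt I x₀).symm z))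
      (mvfderiv I f ((extChartAt I x₀).symm y) ∘L fibreCoordSymm x₀ ((extChartAt I x₀).symm y)) y :=
    hasMFDerivAt_iff_hasFDerivAt (E := E).1 h
  have h3 := congrArg (fun l : E →L[ℝ] F ↦ l (fibreCoord x₀ _ v)) h2.fderiv
  refine h3.trans ?_
  exact congrArg (mvfderiv I f ((extChartAt I x₀).symm y))
    (fibreCoordSymm_fibreCoord (mem_chart_source_of_mem_target hy) v)

/-- Two covariant derivatives differ by a tensor. Once coordinate differentiation is known to be one
on the chart domain, its difference from `cov` is a pointwise bilinear map, from which the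
Christoffel symbols are defined. -/
theorem isCovariantDerivativeOn_chartConnection (x₀ : M) :
    IsCovariantDerivativeOn (I := I) E (chartConnection (I := I) x₀) (chartAt H x₀).source where
  add {σ σ'} {x} hσ hσ' hx := by
    obtain ⟨y, hy, rfl⟩ : ∃ y ∈ (extChartAt I x₀).target, (extChartAt I x₀).symm y = x := by
      rw [← extChartAt_source I] at hx
      exact ⟨_, (extChartAt I x₀).map_source hx, (extChartAt I x₀).left_inv hx⟩
    ext v
    rw [add_apply, chartConnection_symm hy, chartConnection_symm hy,
      chartConnection_symm hy, fieldRep_add,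
      fderiv_add (differentiableAt_fieldRep hy hσ) (differentiableAt_fieldRep hy hσ'),
      add_apply, map_add]
  leibniz {σ f} {x} hσ hf hx := by
    obtain ⟨y, hy, rfl⟩ : ∃ y ∈ (extChartAt I x₀).target, (extChartAt I x₀).symm y = x := by
      rw [← extChartAt_source I] at hx
      exact ⟨_, (extChartAt I x₀).map_source hx, (extChartAt I x₀).left_inv hx⟩
    ext v
    rw [add_apply, smul_apply, chartConnection_symm hy,
      chartConnection_symm hy, fieldRep_smul,
      fderiv_fun_smul (differentiableAt_comp_extChartAt_symm hy hf)
        (differentiableAt_fieldRep hy hσ), add_apply,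
      smul_apply, ContinuousLinearMap.smulRight_apply,
      ContinuousLinearMap.smulRight_apply, map_add, map_smul, map_smul,
      fderiv_comp_extChartAt_symm hy hf]
    congr 2
    exact fibreCoordSymm_fibreCoord hx _

variable [FiniteDimensional ℝ E]

/-- The Christoffel symbols of a connection in the preferred chart at `x₀`. -/
def christoffel (x₀ : M) (cov : Connection I M) (y : E) : E →L[ℝ] E →L[ℝ] E :=
  (ContinuousLinearMap.precomp E (fibreCoordSymm x₀ ((extChartAt I x₀).symm y)) ∘L
    ContinuousLinearMap.postcomp (TangentSpace I ((extChartAt I x₀).symm y))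
      (fibreCoord x₀ ((extChartAt I x₀).symm y)) ∘L
    (cov.isCovariantDerivativeOn (s := (chartAt H x₀).source)).difference
      (isCovariantDerivativeOn_chartConnection x₀) ((extChartAt I x₀).symm y) ∘L
    fibreCoordSymm x₀ ((extChartAt I x₀).symm y)).flip

/-- The classical formula ∇_v σ = dσ(v) + Γ(v, σ). The difference tensor takes the field first and
the direction second; the `flip` in `christoffel` puts the direction first. -/
theorem fibreCoord_cov (cov : Connection I M) {σ : (x : M) → TangentSpace I x}
    (hy : y ∈ (extChartAt I x₀).target)
    (hσ : MDifferentiableAt I I.tangent (fun x ↦ (⟨x, σ x⟩ : TangentBundle I M))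
      ((extChartAt I x₀).symm y)) (v : TangentSpace I ((extChartAt I x₀).symm y)) :
    fibreCoord x₀ _ (cov σ ((extChartAt I x₀).symm y) v) =
      fderiv ℝ (fieldRep x₀ σ) y (fibreCoord x₀ _ v) +
        christoffel x₀ cov y (fibreCoord x₀ _ v) (fieldRep x₀ σ y) := by
  have hx := mem_chart_source_of_mem_target hy
  have h := (cov.isCovariantDerivativeOn (s := (chartAt H x₀).source)).difference_apply
      (isCovariantDerivativeOn_chartConnection x₀) hx hσ
  have h2 : christoffel x₀ cov y (fibreCoord x₀ _ v) (fieldRep x₀ σ y) =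
      fibreCoord x₀ _ ((cov.isCovariantDerivativeOn (s := (chartAt H x₀).source)).difference
      (isCovariantDerivativeOn_chartConnection x₀) ((extChartAt I x₀).symm y)
      (fibreCoordSymm x₀ _ (fibreCoord x₀ _ (σ ((extChartAt I x₀).symm y))))
      (fibreCoordSymm x₀ _ (fibreCoord x₀ _ v))) := rfl
  rw [h2, fibreCoordSymm_fibreCoord hx, fibreCoordSymm_fibreCoord hx, h,
    sub_apply, map_sub, chartConnection_symm hy, fibreCoord_fibreCoordSymm hx]
  abel

theorem fibreCoord_cov_coordField (cov : Connection I M) (hy : y ∈ (extChartAt I x₀).target)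
    (w : E) (v : TangentSpace I ((extChartAt I x₀).symm y)) :
    fibreCoord x₀ _ (cov (coordField x₀ w) ((extChartAt I x₀).symm y) v) =
      christoffel x₀ cov y (fibreCoord x₀ _ v) w := by
  rw [fibreCoord_cov cov hy
    (smoothFieldAt_coordField (mem_chart_source_of_mem_target hy) w).mdifferentiableAt,
    (fieldRep_coordField_eventuallyEq hy w).fderiv_eq, fieldRep_coordField hy, fderiv_fun_const]
  simp

/-- Fields with constant coordinates have zero bracket, so on them vanishing torsion is exactly the
symmetry of Γ. -/
theorem christoffel_symm (cov : Connection I M)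
    (hcov : haveI : CompleteSpace E := FiniteDimensional.complete ℝ E; cov.torsion = 0)
    (hy : y ∈ (extChartAt I x₀).target) (v w : E) :
    christoffel x₀ cov y v w = christoffel x₀ cov y w v := by
  have : CompleteSpace E := FiniteDimensional.complete ℝ E
  have hx := mem_chart_source_of_mem_target hy
  have hs (u : E) := (smoothFieldAt_coordField (I := I) hx u).mdifferentiableAt
  have h := congrArg (fibreCoord x₀ _) (cov.torsion_eq_zero_iff.1 hcov (hs v) (hs w))
  rw [fibreCoord_mlieBracket hy (hs v) (hs w), map_sub, fibreCoord_cov_coordField cov hy,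
    fibreCoord_cov_coordField cov hy, Filter.EventuallyEq.lieBracket_vectorField_eq
      (fieldRep_coordField_eventuallyEq hy v) (fieldRep_coordField_eventuallyEq hy w)] at h
  have hc (u : E) : fibreCoord x₀ _ (coordField (I := I) x₀ u ((extChartAt I x₀).symm y)) = u :=
    fieldRep_coordField hy u
  rw [hc, hc, lieBracket_eq] at h
  simpa [sub_eq_zero] using h

end Christoffel

/-! ### The hypotheses as equations in a chart -/

section LocalEquations

variable {E : Type*} [NormedAddCommGroup E] [NormedSpace ℝ E] [FiniteDimensional ℝ E]

theorem isInvertible_of_pos {b : E →L[ℝ] E →L[ℝ] ℝ} (hb : ∀ v, v ≠ 0 → 0 < b v v) :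
    b.IsInvertible := by
  have hinj : Function.Injective b := by
    rw [injective_iff_map_eq_zero]
    intro v hv
    by_contra hne
    have := hb v hne
    simp [hv] at this
  have hr : Module.finrank ℝ E = Module.finrank ℝ (E →L[ℝ] ℝ) := by
    rw [← (LinearMap.toContinuousLinearMap (𝕜 := ℝ) (E := E) (F' := ℝ)).finrank_eq,
      Module.finrank_linearMap_self]
  let e := LinearEquiv.ofInjectiveOfFinrankEq b.toLinearMap hinj hr
  exact ⟨e.toContinuousLinearEquiv, by ext v; rfl⟩

/-- By compactness the form has a positive minimum m on the unit sphere, and homogeneity gives b(v,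
v) ≥ m‖v‖². Mathlib's Riemannian metrics require this boundedness of the unit ball. -/
theorem isVonNBounded_of_pos {b : E →L[ℝ] E →L[ℝ] ℝ} (hb : ∀ v, v ≠ 0 → 0 < b v v) :
    Bornology.IsVonNBounded ℝ {v : E | b v v < 1} := by
  rw [NormedSpace.isVonNBounded_iff]
  have hc : Continuous fun v : E ↦ b v v := by fun_prop
  rcases subsingleton_or_nontrivial E with hE | hE
  · exact (Set.toFinite _).isBounded
  obtain ⟨u, hu, hmin⟩ := (isCompact_sphere (0 : E) 1).exists_isMinOn
    (NormedSpace.sphere_nonempty.2 zero_le_one) hc.continuousOn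
  have hu0 : u ≠ 0 := by
    rintro rfl
    simp at hu
  have hm := hb u hu0
  -- The bound obtained below is ‖v‖² < 1/m, and t ≤ 1 + t² turns it into the radius 1 + 1/m without
  -- a square root.
  refine (Metric.isBounded_iff_subset_closedBall 0).2 ⟨1 + (b u u)⁻¹, fun v hv ↦ ?_⟩
  rw [mem_closedBall_zero_iff]
  rcases eq_or_ne v 0 with rfl | hv0
  · rw [norm_zero]; positivity
  have hn : 0 < ‖v‖ := norm_pos_iff.2 hv0
  have h1 : b u u ≤ b (‖v‖⁻¹ • v) (‖v‖⁻¹ • v) :=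
    hmin (by simp [norm_smul, hn.ne'])
  simp only [map_smul, smul_apply, smul_eq_mul] at h1
  have h2 : b u u * ‖v‖ ^ 2 ≤ b v v := by
    calc b u u * ‖v‖ ^ 2 ≤ (‖v‖⁻¹ * (‖v‖⁻¹ * b v v)) * ‖v‖ ^ 2 := by gcongr
      _ = b v v := by field_simp
  have h3 : b u u * ‖v‖ ^ 2 < 1 := h2.trans_lt hv
  have h4 : ‖v‖ ^ 2 < (b u u)⁻¹ := by
    rw [← one_div, lt_div_iff₀ hm]
    linarith
  nlinarith

variable {H : Type*} [TopologicalSpace H] {I : ModelWithCorners ℝ E H} [I.Boundaryless]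
  {M : Type*} [TopologicalSpace M] [ChartedSpace H M] [IsManifold I ∞ M] {x₀ : M} {y : E}

omit [FiniteDimensional ℝ E] [I.Boundaryless] in
theorem metricRep_symm (g : SmoothMetric I M) (y v w : E) :
    metricRep x₀ g y v w = metricRep x₀ g y w v :=
  g.symm _ _ _

omit [FiniteDimensional ℝ E] [I.Boundaryless] in
theorem metricRep_pos (hy : y ∈ (extChartAt I x₀).target) (g : SmoothMetric I M) (v : E)
    (hv : v ≠ 0) : 0 < metricRep x₀ g y v v := by
  apply g.pos
  intro h
  apply hv
  rw [← fibreCoord_fibreCoordSymm (I := I) (mem_chart_source_of_mem_target hy) v]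
  exact (congrArg _ h).trans (map_zero _)

theorem fderiv_metricRep {g : SmoothMetric I M} {cov : Connection I M}
    (hcov : IsLeviCivita g cov) (hy : y ∈ (extChartAt I x₀).target) (ξ v w : E) :
    fderiv ℝ (fun z ↦ metricRep x₀ g z v w) y ξ =
      metricRep x₀ g y (christoffel x₀ cov y ξ v) w +
        metricRep x₀ g y v (christoffel x₀ cov y ξ w) := by
  have hx := mem_chart_source_of_mem_target hy
  have h := hcov.2 ((extChartAt I x₀).symm y) (fibreCoordSymm x₀ _ ξ) _ _
    (smoothFieldAt_coordField (I := I) hx v) (smoothFieldAt_coordField (I := I) hx w)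
  have hm : MDifferentiableAt I 𝓘(ℝ, ℝ)
      (fun z ↦ g.inner z (coordField x₀ v z) (coordField x₀ w z)) ((extChartAt I x₀).symm y) := by
    have h1 : MDifferentiableAt I (I.prod 𝓘(ℝ, ℝ))
        (fun z ↦ TotalSpace.mk' ℝ (E := Bundle.Trivial M ℝ) z
          (g.inner z (coordField x₀ v z) (coordField x₀ w z))) ((extChartAt I x₀).symm y) := by
      apply MDifferentiableAt.clm_bundle_apply₂ (F₁ := E) (F₂ := E)
      · exact g.contMDiff.contMDiffAt.mdifferentiableAt (by simp)
      · exact (smoothFieldAt_coordField (I := I) hx v).mdifferentiableAt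
      · exact (smoothFieldAt_coordField (I := I) hx w).mdifferentiableAt
    rw [mdifferentiableAt_totalSpace] at h1
    exact h1.2
  rw [← fderiv_comp_extChartAt_symm hy hm, inner_eq_metricRep hy, inner_eq_metricRep hy,
    fibreCoord_cov_coordField cov hy, fibreCoord_cov_coordField cov hy,
    fibreCoord_fibreCoordSymm hx] at h
  have hc (u : E) : fibreCoord x₀ _ (coordField (I := I) x₀ u ((extChartAt I x₀).symm y)) = u :=
    fieldRep_coordField hy u
  rw [hc, hc] at h
  exact h

/-- The Koszul formula on coordinate fields: expand the three derivatives of the metric by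
compatibility and cancel using the symmetry of Γ and of `g`. -/
theorem metricRep_christoffel {g : SmoothMetric I M} {cov : Connection I M}
    (hcov : IsLeviCivita g cov) (hy : y ∈ (extChartAt I x₀).target) (v w z : E) :
    metricRep x₀ g y (christoffel x₀ cov y v w) z =
      (1 / 2 : ℝ) * (fderiv ℝ (fun u ↦ metricRep x₀ g u w z) y v +
        fderiv ℝ (fun u ↦ metricRep x₀ g u v z) y w -
        fderiv ℝ (fun u ↦ metricRep x₀ g u v w) y z) := by
  rw [fderiv_metricRep hcov hy, fderiv_metricRep hcov hy, fderiv_metricRep hcov hy,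
    christoffel_symm cov hcov.1 hy w v, christoffel_symm cov hcov.1 hy z v,
    christoffel_symm cov hcov.1 hy z w, metricRep_symm g y w, metricRep_symm g y v]
  ring

set_option synthInstance.maxHeartbeats 200000 in
-- The Koszul formula expresses g(Γ(v, w), ·) by first derivatives of the smooth metric; applying
-- the inverse of the metric, which is also smooth, recovers Γ.
theorem contDiffAt_christoffel {g : SmoothMetric I M} {cov : Connection I M}
    (hcov : IsLeviCivita g cov) (hy : y ∈ (extChartAt I x₀).target) :
    ContDiffAt ℝ ∞ (christoffel x₀ cov) y := by
  -- In finite dimension, smoothness of a map into linear maps can be tested on fixed vectors. The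
  -- criterion is applied on the whole open chart target, where the Koszul formula holds.
  suffices h : ContDiffOn ℝ ∞ (christoffel x₀ cov) (extChartAt I x₀).target from
    h.contDiffAt (target_mem_nhds hy)
  have : CompleteSpace E := FiniteDimensional.complete ℝ E
  have hg (y) (hy : y ∈ (extChartAt I x₀).target) := contDiffAt_metricRep hy g
  rw [contDiffOn_clm_apply]
  intro v
  rw [contDiffOn_clm_apply]
  intro w
  have hK : ContDiffOn ℝ ∞ (fun y ↦ metricRep x₀ g y (christoffel x₀ cov y v w))
      (extChartAt I x₀).target := by
    rw [contDiffOn_clm_apply]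
    intro z
    have h1 : ContDiffOn ℝ ∞ (fun y ↦ (1 / 2 : ℝ) * (fderiv ℝ (fun u ↦ metricRep x₀ g u w z) y v +
        fderiv ℝ (fun u ↦ metricRep x₀ g u v z) y w -
        fderiv ℝ (fun u ↦ metricRep x₀ g u v w) y z))
        (extChartAt I x₀).target := by
      intro y hy
      have hd (a b c : E) : ContDiffAt ℝ ∞ (fun y ↦ fderiv ℝ (fun u ↦ metricRep x₀ g u b c) y a) y :=
        ((((hg y hy).clm_apply contDiffAt_const).clm_apply contDiffAt_const).fderiv_right
          (by simp)).clm_apply contDiffAt_const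
      exact (contDiffAt_const.mul (((hd v w z).add (hd w v z)).sub (hd z v w))).contDiffWithinAt
    exact h1.congr fun y' hy' ↦ metricRep_christoffel hcov hy' v w z
  have hinv (y) (hy : y ∈ (extChartAt I x₀).target) := isInvertible_of_pos (metricRep_pos hy g)
  have hi : ContDiffOn ℝ ∞ (fun y ↦ (metricRep x₀ g y).inverse) (extChartAt I x₀).target := by
    intro y hy
    obtain ⟨e, he⟩ := hinv y hy
    refine (ContDiffAt.comp (g := ContinuousLinearMap.inverse) y ?_ (hg y hy)).contDiffWithinAt
    rw [← he]
    exact contDiffAt_map_inverse e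
  exact (hi.clm_apply hK).congr fun y' hy' ↦ ((hinv y' hy').inverse_apply_self _).symm

/-- This is ∇J = 0 evaluated on a field with constant coordinates w. -/
theorem fderiv_endRep {J : EndField I M} {cov : Connection I M} (hJ : IsSmoothEndField J)
    (hp : IsParallel cov J) (hy : y ∈ (extChartAt I x₀).target) (ξ w : E) :
    fderiv ℝ (endRep x₀ J) y ξ w =
      endRep x₀ J y (christoffel x₀ cov y ξ w) - christoffel x₀ cov y ξ (endRep x₀ J y w) := by
  have hx := mem_chart_source_of_mem_target hy
  have hw := smoothFieldAt_coordField (I := I) hx w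
  have h := congrArg (fibreCoord x₀ _) (sub_eq_zero.1
    (hp ((extChartAt I x₀).symm y) (fibreCoordSymm x₀ _ ξ) _ hw))
  have hJw : SmoothFieldAt (fun x ↦ J x (coordField x₀ w x)) ((extChartAt I x₀).symm y) :=
    ContMDiffAt.clm_bundle_apply (hJ _) hw
  have hrep : fieldRep x₀ (fun x ↦ J x (coordField x₀ w x)) = fun z ↦ endRep x₀ J z w := rfl
  rw [fibreCoord_cov cov hy hJw.mdifferentiableAt, fibreCoord_end hy,
    fibreCoord_cov_coordField cov hy, fibreCoord_fibreCoordSymm hx, hrep] at h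
  rw [← h]
  have hd := (contDiffAt_endRep hy hJ).differentiableAt (by simp)
  have h3 := congrArg (fun l : E →L[ℝ] E ↦ l ξ)
    (hd.hasFDerivAt.clm_apply (hasFDerivAt_const w y)).fderiv
  simp at h3
  simp [h3]

set_option synthInstance.maxHeartbeats 200000 in
-- On coordinate fields the bracket term of the curvature drops out, leaving dΓ and the products of
-- two Γ. The iterated derivative is legitimate because Γ is smooth.
theorem curvature_christoffel {g : SmoothMetric I M} {cov : Connection I M}
    (hcov : IsLeviCivita g cov) (hf : IsFlat cov) (hy : y ∈ (extChartAt I x₀).target)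
    (ξ η v : E) :
    fderiv ℝ (christoffel x₀ cov) y ξ η v + christoffel x₀ cov y ξ (christoffel x₀ cov y η v) =
      fderiv ℝ (christoffel x₀ cov) y η ξ v +
        christoffel x₀ cov y η (christoffel x₀ cov y ξ v) := by
  have : CompleteSpace E := FiniteDimensional.complete ℝ E
  have hx := mem_chart_source_of_mem_target hy
  have hs (u : E) := smoothFieldAt_coordField (I := I) hx u
  have hc (u : E) : fibreCoord x₀ _ (coordField (I := I) x₀ u ((extChartAt I x₀).symm y)) = u :=
    fieldRep_coordField hy u
  have hΓ := contDiffAt_christoffel hcov hy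
  have hrep (u : E) : fieldRep x₀ (fun z ↦ cov (coordField x₀ v) z (coordField x₀ u z))
      =ᶠ[nhds y] fun z ↦ christoffel x₀ cov z u v := by
    filter_upwards [target_mem_nhds hy] with z hz
    refine (fibreCoord_cov_coordField cov hz v _).trans ?_
    exact congrArg (christoffel x₀ cov z · v) (fieldRep_coordField hz u)
  have hmd (u : E) : MDifferentiableAt I I.tangent
      (fun z ↦ (⟨z, cov (coordField x₀ v) z (coordField x₀ u z)⟩ : TangentBundle I M))
      ((extChartAt I x₀).symm y) :=
    mdifferentiableAt_of_fieldRep hy ((((hΓ.differentiableAt (by simp)).clm_apply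
      (differentiableAt_const u)).clm_apply (differentiableAt_const v)).congr_of_eventuallyEq
      (hrep u))
  have hd (ζ u : E) : fderiv ℝ (fun z ↦ christoffel x₀ cov z u v) y ζ =
      fderiv ℝ (christoffel x₀ cov) y ζ u v := by
    have hd := hΓ.differentiableAt (by simp)
    have h3 := congrArg (fun l : E →L[ℝ] E ↦ l ζ)
      ((hd.hasFDerivAt.clm_apply (hasFDerivAt_const u y)).clm_apply (hasFDerivAt_const v y)).fderiv
    simp only [add_apply] at h3
    simpa using h3
  have h := congrArg (fibreCoord x₀ _) (hf ((extChartAt I x₀).symm y) _ _ _ (hs ξ) (hs η) (hs v))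
  rw [curvature, map_sub, map_sub, fibreCoord_cov cov hy (hmd η), fibreCoord_cov cov hy (hmd ξ),
    (hrep η).fderiv_eq, (hrep ξ).fderiv_eq, (hrep η).eq_of_nhds, (hrep ξ).eq_of_nhds,
    fibreCoord_cov_coordField cov hy, hc, hc, fibreCoord_mlieBracket hy (hs ξ).mdifferentiableAt
      (hs η).mdifferentiableAt, Filter.EventuallyEq.lieBracket_vectorField_eq
      (fieldRep_coordField_eventuallyEq hy ξ) (fieldRep_coordField_eventuallyEq hy η), hd, hd,
    map_zero, lieBracket_eq] at h
  simpa [sub_eq_zero] using h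

end LocalEquations

/-! ### Vertical and horizontal lifts in the charts of `TM` -/

section TangentBundleChart

variable {E : Type*} [NormedAddCommGroup E] [NormedSpace ℝ E]
  {H : Type*} [TopologicalSpace H] {I : ModelWithCorners ℝ E H}
  {M : Type*} [TopologicalSpace M] [ChartedSpace H M] [IsManifold I ∞ M] {y : E}

theorem extChartAt_tangent_apply (a₀ a : TangentBundle I M) :
    extChartAt I.tangent a₀ a = (extChartAt I a₀.proj a.proj,
      (trivializationAt E (TangentSpace I : M → Type _) a₀.proj a).2) :=
  rfl

theorem extChartAt_tangent_eq_fibreCoord (a₀ : TangentBundle I M) {x : M}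
    (hx : x ∈ (chartAt H a₀.proj).source) (v : TangentSpace I x) :
    extChartAt I.tangent a₀ ⟨x, v⟩ = (extChartAt I a₀.proj x, fibreCoord a₀.proj x v) := by
  rw [extChartAt_tangent_apply, fibreCoord_eq_snd hx]

theorem mem_target_tangent {a₀ : TangentBundle I M} {z : E × E}
    (hz : z ∈ (extChartAt I.tangent a₀).target) : z.1 ∈ (extChartAt I a₀.proj).target := by
  have h := (extChartAt I.tangent a₀).map_target hz
  rw [extChartAt_source, TangentBundle.mem_chart_source_iff, ← extChartAt_source I] at h
  have h2 := congrArg Prod.fst ((extChartAt I.tangent a₀).right_inv hz)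
  rw [extChartAt_tangent_apply] at h2
  rw [← h2]
  exact (extChartAt I a₀.proj).map_source h

theorem extChartAt_tangent_symm {a₀ : TangentBundle I M} {z : E × E}
    (hz : z ∈ (extChartAt I.tangent a₀).target) :
    (extChartAt I.tangent a₀).symm z = ⟨(extChartAt I a₀.proj).symm z.1,
      fibreCoordSymm a₀.proj ((extChartAt I a₀.proj).symm z.1) z.2⟩ := by
  have hx := mem_chart_source_of_mem_target (mem_target_tangent hz)
  have h : extChartAt I.tangent a₀ ⟨(extChartAt I a₀.proj).symm z.1,
      fibreCoordSymm a₀.proj ((extChartAt I a₀.proj).symm z.1) z.2⟩ = z := by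
    rw [extChartAt_tangent_eq_fibreCoord a₀ hx, fibreCoord_fibreCoordSymm hx,
      (extChartAt I a₀.proj).right_inv (mem_target_tangent hz)]
  nth_rw 1 [← h]
  apply (extChartAt I.tangent a₀).left_inv
  rw [extChartAt_source, TangentBundle.mem_chart_source_iff]
  exact hx

/-- Along a fibre the chart of `TM` has constant base component and a linear fibre component, which
is its own derivative. -/
theorem fibreCoord_vertical (a₀ a : TangentBundle I M)
    (ha : a.proj ∈ (chartAt H a₀.proj).source) (w : TangentSpace I a.proj) :
    fibreCoord (I := I.tangent) a₀ a (vertical a w) = (0, fibreCoord a₀.proj a.proj w) := by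
  have ha' : a ∈ (chartAt (ModelProd H E) a₀).source :=
    (TangentBundle.mem_chart_source_iff a a₀).2 ha
  rw [fibreCoord_eq_mfderiv (I := I.tangent) ha']
  let L : E →L[ℝ] E := fibreCoord (I := I) a₀.proj a.proj
  have h1 := HasMFDerivAt.comp (I := 𝓘(ℝ, E)) (I' := I.tangent) (I'' := 𝓘(ℝ, E × E)) (M := E)
    (f := fun v : E ↦ (⟨a.proj, v⟩ : TangentBundle I M)) a.snd
    (mdifferentiableAt_extChartAt (I := I.tangent) (y := (⟨a.proj, a.snd⟩ : TangentBundle I M))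
      ha').hasMFDerivAt
    ((smooth_fibreIncl (I := I) a.proj).mdifferentiable (by simp) (a.snd : E)).hasMFDerivAt
  have h2 : HasMFDerivAt 𝓘(ℝ, E) 𝓘(ℝ, E × E) (fun v : E ↦ ((extChartAt I a₀.proj a.proj, L v) : E × E)) (a.snd : E)
      ((0 : E →L[ℝ] E).prod L) :=
    HasFDerivAt.hasMFDerivAt ((hasFDerivAt_const _ _).prodMk L.hasFDerivAt)
  have h3 : (extChartAt I.tangent a₀ ∘ fun v : E ↦ (⟨a.proj, v⟩ : TangentBundle I M)) =
      fun v : E ↦ ((extChartAt I a₀.proj a.proj, L v) : E × E) := by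
    funext v
    exact extChartAt_tangent_eq_fibreCoord a₀ ha v
  rw [h3] at h1
  exact congrArg (fun l : E →L[ℝ] E × E ↦ l w) (hasMFDerivAt_unique h1 h2)

variable [I.Boundaryless]

theorem fibreCoord_mfderiv_section (a₀ : TangentBundle I M) {σ : (x : M) → TangentSpace I x}
    (hy : y ∈ (extChartAt I a₀.proj).target)
    (hσ : MDifferentiableAt I I.tangent (fun x ↦ (⟨x, σ x⟩ : TangentBundle I M))
      ((extChartAt I a₀.proj).symm y)) (v : TangentSpace I ((extChartAt I a₀.proj).symm y)) :
    fibreCoord (I := I.tangent) a₀ (⟨_, σ ((extChartAt I a₀.proj).symm y)⟩ : TangentBundle I M)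
      (mfderiv I I.tangent (fun x ↦ (⟨x, σ x⟩ : TangentBundle I M))
        ((extChartAt I a₀.proj).symm y) v) =
      (fibreCoord a₀.proj _ v, fderiv ℝ (fieldRep a₀.proj σ) y (fibreCoord a₀.proj _ v)) := by
  have hx := mem_chart_source_of_mem_target hy
  have ha' : (⟨_, σ ((extChartAt I a₀.proj).symm y)⟩ : TangentBundle I M) ∈
      (chartAt (ModelProd H E) a₀).source :=
    (TangentBundle.mem_chart_source_iff _ a₀).2 hx
  rw [fibreCoord_eq_mfderiv (I := I.tangent) ha']
  have hc := MDifferentiableAt.comp (f := fun x ↦ (⟨x, σ x⟩ : TangentBundle I M))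
    ((extChartAt I a₀.proj).symm y) (mdifferentiableAt_extChartAt (I := I.tangent) ha') hσ
  have h1 := fderiv_comp_extChartAt_symm hy hc v
  have h2 : (fun z ↦ (extChartAt I.tangent a₀ ∘ fun x ↦ (⟨x, σ x⟩ : TangentBundle I M))
      ((extChartAt I a₀.proj).symm z)) =ᶠ[nhds y] fun z ↦ (z, fieldRep a₀.proj σ z) := by
    filter_upwards [target_mem_nhds hy] with z hz
    refine (extChartAt_tangent_eq_fibreCoord a₀ (mem_chart_source_of_mem_target hz) _).trans ?_
    rw [(extChartAt I a₀.proj).right_inv hz]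
    rfl
  have h3 : HasFDerivAt (fun z ↦ (z, fieldRep a₀.proj σ z))
      ((ContinuousLinearMap.id ℝ E).prod (fderiv ℝ (fieldRep a₀.proj σ) y)) y :=
    (hasFDerivAt_id y).prodMk (differentiableAt_fieldRep hy hσ).hasFDerivAt
  rw [h2.fderiv_eq, h3.fderiv] at h1
  refine Eq.trans ?_ h1.symm
  have h4 := mfderiv_comp (f := fun x ↦ (⟨x, σ x⟩ : TangentBundle I M)) _
    (mdifferentiableAt_extChartAt (I := I.tangent) ha') hσ
  exact (congrArg (fun l : E →L[ℝ] E × E ↦ l v) h4).symm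

variable [FiniteDimensional ℝ E]

/-- The derivative of the chosen extension σ occurs both in dσ(v) and in ∇_v σ and cancels in the
difference. Only -Γ(v, u) survives, so the lift does not depend on the extension. -/
theorem fibreCoord_horizontal (cov : Connection I M) (a₀ : TangentBundle I M)
    (hy : y ∈ (extChartAt I a₀.proj).target) (u v : TangentSpace I ((extChartAt I a₀.proj).symm y)) :
    fibreCoord (I := I.tangent) a₀ (⟨_, u⟩ : TangentBundle I M) (horizontal cov ⟨_, u⟩ v) =
      (fibreCoord a₀.proj _ v,
        -christoffel a₀.proj cov y (fibreCoord a₀.proj _ v) (fibreCoord a₀.proj _ u)) := by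
  have hx := mem_chart_source_of_mem_target hy
  have hσ := FiberBundle.mdifferentiableAt_extend I E u
  have hu : FiberBundle.extend E u ((extChartAt I a₀.proj).symm y) = u :=
    FiberBundle.extend_apply_self E u
  have h1 := fibreCoord_mfderiv_section a₀ hy hσ v
  have h2 := fibreCoord_vertical a₀ ⟨_, u⟩ hx (cov (FiberBundle.extend E u) _ v)
  rw [fibreCoord_cov cov hy hσ] at h2
  have h3 : fieldRep a₀.proj (FiberBundle.extend E u) y = fibreCoord a₀.proj _ u :=
    congrArg _ hu
  rw [h3] at h2
  rw [hu] at h1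
  have hsub (L : E × E →L[ℝ] E × E) {p q r s : E × E} (hp : L p = r) (hq : L q = s) :
      L (p - q) = r - s := by rw [map_sub, hp, hq]
  exact (hsub _ h1 h2).trans (by ext <;> simp)

end TangentBundleChart

/-! ### The lifted structure and metric on `E × E` -/

section LiftModel

variable {E : Type*} [NormedAddCommGroup E] [NormedSpace ℝ E]

/-- The lift to `E × E`, at the point with fibre coordinate `v`, of an endomorphism `J` of `E` by
means of a connection with Christoffel symbols `Γ`. -/
def liftModel (J : E →L[ℝ] E) (Γ : E →L[ℝ] E →L[ℝ] E) (v : E) : E × E →L[ℝ] E × E :=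
  ContinuousLinearMap.inl ℝ E E ∘L J ∘L ContinuousLinearMap.fst ℝ E E +
    ContinuousLinearMap.inr ℝ E E ∘L (J ∘L ContinuousLinearMap.snd ℝ E E +
      J ∘L Γ.flip v ∘L ContinuousLinearMap.fst ℝ E E -
      Γ.flip v ∘L J ∘L ContinuousLinearMap.fst ℝ E E)

/-- The vertical part of ζ is ζ.2 + Γ(ζ.1, v). Applying `J` to it and subtracting the correction
Γ(Jζ.1, v) of the new horizontal part gives the second component. -/
theorem liftModel_apply (J : E →L[ℝ] E) (Γ : E →L[ℝ] E →L[ℝ] E) (v : E) (ζ : E × E) :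
    liftModel J Γ v ζ = (J ζ.1, J ζ.2 + J (Γ ζ.1 v) - Γ (J ζ.1) v) := by
  simp [liftModel]

/-- The vertical projection of `E × E`, at the point with fibre coordinate `v`, of a connection
with Christoffel symbols `Γ`. -/
def connectorModel (Γ : E →L[ℝ] E →L[ℝ] E) (v : E) : E × E →L[ℝ] E :=
  ContinuousLinearMap.snd ℝ E E + Γ.flip v ∘L ContinuousLinearMap.fst ℝ E E

theorem connectorModel_apply (Γ : E →L[ℝ] E →L[ℝ] E) (v : E) (ζ : E × E) :
    connectorModel Γ v ζ = ζ.2 + Γ ζ.1 v := by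
  simp [connectorModel]

/-- The pullback of a bilinear form by a linear map. -/
def bilinPullback {F : Type*} [NormedAddCommGroup F] [NormedSpace ℝ F] (b : E →L[ℝ] E →L[ℝ] ℝ)
    (P : F →L[ℝ] E) : F →L[ℝ] F →L[ℝ] ℝ :=
  ((b ∘L P).flip ∘L P).flip

theorem bilinPullback_apply {F : Type*} [NormedAddCommGroup F] [NormedSpace ℝ F]
    (b : E →L[ℝ] E →L[ℝ] ℝ) (P : F →L[ℝ] E) (v w : F) :
    bilinPullback b P v w = b (P v) (P w) := by
  simp [bilinPullback]

/-- The Sasaki-type lift to `E × E`, at the point with fibre coordinate `v`, of a bilinear form on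
`E` by means of a connection with Christoffel symbols `Γ`. -/
def liftMetricModel (b : E →L[ℝ] E →L[ℝ] ℝ) (Γ : E →L[ℝ] E →L[ℝ] E) (v : E) :
    E × E →L[ℝ] E × E →L[ℝ] ℝ :=
  bilinPullback b (ContinuousLinearMap.fst ℝ E E) + bilinPullback b (connectorModel Γ v)

theorem liftMetricModel_apply (b : E →L[ℝ] E →L[ℝ] ℝ) (Γ : E →L[ℝ] E →L[ℝ] E) (v : E)
    (ζ η : E × E) : liftMetricModel b Γ v ζ η =
      b ζ.1 η.1 + b (ζ.2 + Γ ζ.1 v) (η.2 + Γ η.1 v) := by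
  simp [liftMetricModel, bilinPullback_apply, connectorModel_apply]

set_option synthInstance.maxHeartbeats 200000 in
theorem contDiffAt_clm_flip {D F G K : Type*} [NormedAddCommGroup D] [NormedSpace ℝ D]
    [NormedAddCommGroup F] [NormedSpace ℝ F] [NormedAddCommGroup G] [NormedSpace ℝ G]
    [NormedAddCommGroup K] [NormedSpace ℝ K] {f : D → F →L[ℝ] G →L[ℝ] K} {z : D} {n : ℕ∞ω}
    (hf : ContDiffAt ℝ n f z) : ContDiffAt ℝ n (fun y ↦ (f y).flip) z := by
  have h : ContDiff ℝ n fun l : F →L[ℝ] G →L[ℝ] K ↦ l.flip :=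
    IsBoundedLinearMap.contDiff (E := F →L[ℝ] G →L[ℝ] K) (F := G →L[ℝ] F →L[ℝ] K)
      { map_add := fun _ _ ↦ rfl
        map_smul := fun _ _ ↦ rfl
        bound := ⟨1, one_pos, fun l ↦ by rw [ContinuousLinearMap.opNorm_flip, one_mul]⟩ }
  exact h.contDiffAt.comp z hf

variable {J : E → E →L[ℝ] E} {Γ : E → E →L[ℝ] E →L[ℝ] E} {y : E}

theorem contDiffAt_liftModel {z : E × E} (hJ : ContDiffAt ℝ ∞ J z.1) (hΓ : ContDiffAt ℝ ∞ Γ z.1) :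
    ContDiffAt ℝ ∞ (fun z : E × E ↦ liftModel (J z.1) (Γ z.1) z.2) z := by
  have hJ' : ContDiffAt ℝ ∞ (fun z : E × E ↦ J z.1) z := hJ.comp z contDiffAt_fst
  have hK : ContDiffAt ℝ ∞ (fun z : E × E ↦ (Γ z.1).flip z.2) z :=
    (contDiffAt_clm_flip (hΓ.comp z contDiffAt_fst)).clm_apply contDiffAt_snd
  exact (contDiffAt_const.clm_comp (hJ'.clm_comp contDiffAt_const)).add
    (contDiffAt_const.clm_comp (((hJ'.clm_comp contDiffAt_const).add
      (hJ'.clm_comp (hK.clm_comp contDiffAt_const))).sub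
      (hK.clm_comp (hJ'.clm_comp contDiffAt_const))))

theorem contDiffAt_bilinPullback {D F : Type*} [NormedAddCommGroup D] [NormedSpace ℝ D]
    [NormedAddCommGroup F] [NormedSpace ℝ F] {b : D → E →L[ℝ] E →L[ℝ] ℝ} {P : D → F →L[ℝ] E} {z : D}
    (hb : ContDiffAt ℝ ∞ b z) (hP : ContDiffAt ℝ ∞ P z) :
    ContDiffAt ℝ ∞ (fun z ↦ bilinPullback (b z) (P z)) z :=
  contDiffAt_clm_flip ((contDiffAt_clm_flip (hb.clm_comp hP)).clm_comp hP)

theorem contDiffAt_liftMetricModel {b : E → E →L[ℝ] E →L[ℝ] ℝ} {z : E × E}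
    (hb : ContDiffAt ℝ ∞ b z.1) (hΓ : ContDiffAt ℝ ∞ Γ z.1) :
    ContDiffAt ℝ ∞ (fun z : E × E ↦ liftMetricModel (b z.1) (Γ z.1) z.2) z := by
  have hb' : ContDiffAt ℝ ∞ (fun z : E × E ↦ b z.1) z := hb.comp z contDiffAt_fst
  have hK : ContDiffAt ℝ ∞ (fun z : E × E ↦ (Γ z.1).flip z.2) z :=
    (contDiffAt_clm_flip (hΓ.comp z contDiffAt_fst)).clm_apply contDiffAt_snd
  exact (contDiffAt_bilinPullback hb' contDiffAt_const).add
    (contDiffAt_bilinPullback hb' (contDiffAt_const.add (hK.clm_comp contDiffAt_const)))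

/-- The Nijenhuis tensor at `z` of a field of endomorphisms of a normed space, in terms of its
derivative. -/
def nijenhuisModel (A : E → E →L[ℝ] E) (z ζ η : E) : E :=
  fderiv ℝ A z (A z ζ) η - fderiv ℝ A z (A z η) ζ - A z (fderiv ℝ A z ζ η) +
    A z (fderiv ℝ A z η ζ)

theorem nijenhuisModel_congr {A B : E → E →L[ℝ] E} {z : E} (h : A =ᶠ[nhds z] B) (ζ η : E) :
    nijenhuisModel A z ζ η = nijenhuisModel B z ζ η := by
  rw [nijenhuisModel, nijenhuisModel, h.fderiv_eq, h.eq_of_nhds]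

set_option synthInstance.maxHeartbeats 200000 in
theorem fderiv_liftModel_apply (hJ : ContDiffAt ℝ ∞ J y) (hΓ : ContDiffAt ℝ ∞ Γ y)
    (v : E) (η ζ : E × E) :
    fderiv ℝ (fun z : E × E ↦ liftModel (J z.1) (Γ z.1) z.2) (y, v) η ζ =
      (fderiv ℝ J y η.1 ζ.1,
        fderiv ℝ J y η.1 ζ.2 + (fderiv ℝ J y η.1 (Γ y ζ.1 v) +
          J y (fderiv ℝ Γ y η.1 ζ.1 v + Γ y ζ.1 η.2)) -
          (fderiv ℝ Γ y η.1 (J y ζ.1) v + Γ y (fderiv ℝ J y η.1 ζ.1) v + Γ y (J y ζ.1) η.2)) := by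
  have hd : DifferentiableAt ℝ (fun z : E × E ↦ liftModel (J z.1) (Γ z.1) z.2) (y, v) :=
    (contDiffAt_liftModel (z := (y, v)) hJ hΓ).differentiableAt (by simp)
  have h1 := congrArg (fun l : E × E →L[ℝ] E × E ↦ l η)
    (hd.hasFDerivAt.clm_apply (hasFDerivAt_const ζ (y, v))).fderiv
  -- Evaluating at the fixed vector ζ first allows the product rule to be applied to the explicit
  -- formula for the two components.
  have h2 : fderiv ℝ (fun z : E × E ↦ liftModel (J z.1) (Γ z.1) z.2 ζ) (y, v) η =
      fderiv ℝ (fun z : E × E ↦ liftModel (J z.1) (Γ z.1) z.2) (y, v) η ζ := by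
    simpa using h1
  rw [← h2]
  simp only [liftModel_apply]
  have hJ1 : HasFDerivAt (fun z : E × E ↦ J z.1)
      (fderiv ℝ J y ∘L ContinuousLinearMap.fst ℝ E E) (y, v) :=
    HasFDerivAt.comp (g := J) (y, v) (hJ.differentiableAt (by simp)).hasFDerivAt hasFDerivAt_fst
  have hΓ1 : HasFDerivAt (fun z : E × E ↦ Γ z.1)
      (fderiv ℝ Γ y ∘L ContinuousLinearMap.fst ℝ E E) (y, v) :=
    HasFDerivAt.comp (g := Γ) (f := Prod.fst) (y, v) (hΓ.differentiableAt (by simp)).hasFDerivAt hasFDerivAt_fst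
  have hc (w : E) := hasFDerivAt_const (𝕜 := ℝ) w ((y, v) : E × E)
  have hs : HasFDerivAt (fun z : E × E ↦ z.2) (ContinuousLinearMap.snd ℝ E E) (y, v) :=
    hasFDerivAt_snd
  have h3 := (hJ1.clm_apply (hc ζ.1)).prodMk (((hJ1.clm_apply (hc ζ.2)).add
    (hJ1.clm_apply ((hΓ1.clm_apply (hc ζ.1)).clm_apply hs))).sub
    ((hΓ1.clm_apply (hJ1.clm_apply (hc ζ.1))).clm_apply hs))
  refine (congrArg (fun l : E × E →L[ℝ] E × E ↦ l η) h3.fderiv).trans ?_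
  simp
  abel

/-- Parallelism removes every derivative of `J`. The derivatives of Γ then occur in pairs
antisymmetric in their first two arguments, one pair for each of (JX, JY), (JX, Y), (X, JY) and (X,
Y); zero curvature turns each pair into products of Γ, and these cancel by symmetry of Γ. -/
theorem nijenhuisModel_liftModel (hJ : ContDiffAt ℝ ∞ J y) (hΓ : ContDiffAt ℝ ∞ Γ y)
    (hsymm : ∀ v w, Γ y v w = Γ y w v)
    (hpar : ∀ ξ w, fderiv ℝ J y ξ w = J y (Γ y ξ w) - Γ y ξ (J y w))
    (hflat : ∀ ξ η v, fderiv ℝ Γ y ξ η v + Γ y ξ (Γ y η v) =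
      fderiv ℝ Γ y η ξ v + Γ y η (Γ y ξ v))
    (v : E) (ζ η : E × E) :
    nijenhuisModel (fun z : E × E ↦ liftModel (J z.1) (Γ z.1) z.2) (y, v) ζ η = 0 := by
  obtain ⟨X, W⟩ := ζ
  obtain ⟨Y, V⟩ := η
  have hf (ξ η : E) : fderiv ℝ Γ y ξ η v =
      fderiv ℝ Γ y η ξ v + Γ y η (Γ y ξ v) - Γ y ξ (Γ y η v) := by
    rw [← hflat ξ η v]; abel
  simp only [nijenhuisModel, fderiv_liftModel_apply hJ hΓ, liftModel_apply, hpar, map_add, map_sub,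
    sub_apply]
  -- One member of each of the four pairs is rewritten by hand: the identity exchanges its two
  -- arguments, so it has no terminating direction as a simplification rule.
  rw [hf (J y Y) (J y X), hf (J y Y) X, hf Y (J y X), hf Y X]
  simp only [map_add, map_sub, hsymm Y X, hsymm Y (J y X), hsymm (J y Y) X,
    hsymm (J y Y) (J y X)]
  ext
  · simp only [Prod.fst_add, Prod.fst_sub, Prod.fst_zero]
    abel
  · simp only [Prod.snd_add, Prod.snd_sub, Prod.snd_zero]
    abel

end LiftModel

/-! ### From coordinate expressions back to the manifold -/

section SmoothnessFromCharts

variable {E : Type*} [NormedAddCommGroup E] [NormedSpace ℝ E]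
  {H : Type*} [TopologicalSpace H] {I : ModelWithCorners ℝ E H} [I.Boundaryless]
  {M : Type*} [TopologicalSpace M] [ChartedSpace H M] [IsManifold I ∞ M]

omit [I.Boundaryless] in
-- Smoothness of a section at a point is tested in the trivialization centred at that point, so the
-- centre of each preferred chart suffices.
theorem isSmoothEndField_of_endRep {J : EndField I M}
    (h : ∀ x₀ : M, ContDiffAt ℝ ∞ (endRep x₀ J) (extChartAt I x₀ x₀)) : IsSmoothEndField J := by
  intro x₀
  rw [contMDiffAt_section]
  refine ((h x₀).contMDiffAt.comp x₀ contMDiffAt_extChartAt).congr_of_eventuallyEq ?_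
  filter_upwards [(chartAt H x₀).open_source.mem_nhds (mem_chart_source H x₀)] with z hz
  rw [hom_trivializationAt_apply, Function.comp_apply, endRep,
    (extChartAt I x₀).left_inv (by rwa [extChartAt_source])]
  rfl

set_option synthInstance.maxHeartbeats 400000 in
omit [I.Boundaryless] in
theorem contMDiff_of_bilinRep {b : (x : M) → TangentSpace I x →L[ℝ] TangentSpace I x →L[ℝ] ℝ}
    (h : ∀ x₀ : M, ContDiffAt ℝ ∞ (bilinRep x₀ b) (extChartAt I x₀ x₀)) :
    ContMDiff I (I.prod 𝓘(ℝ, E →L[ℝ] E →L[ℝ] ℝ)) ∞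
      (fun x ↦ TotalSpace.mk' (E →L[ℝ] E →L[ℝ] ℝ)
        (E := fun x : M ↦ TangentSpace I x →L[ℝ] TangentSpace I x →L[ℝ] ℝ) x (b x)) := by
  intro x₀
  rw [contMDiffAt_section]
  refine ((h x₀).contMDiffAt.comp x₀ contMDiffAt_extChartAt).congr_of_eventuallyEq ?_
  filter_upwards [(chartAt H x₀).open_source.mem_nhds (mem_chart_source H x₀)] with z hz
  rw [← extChartAt_source I] at hz
  have h1 := inCoordinates_eq_bilinRep ((extChartAt I x₀).map_source hz) b
  rw [(extChartAt I x₀).left_inv hz] at h1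
  rw [hom_trivializationAt_apply, Function.comp_apply]
  exact h1

/-- Tensoriality of the Nijenhuis tensor: after expanding the four brackets by the product rule, the
derivatives of `X` and `Y` cancel and only derivatives of `J` remain. -/
theorem fibreCoord_nijenhuis [CompleteSpace E] {J : EndField I M} (hJ : IsSmoothEndField J)
    {X Y : (x : M) → TangentSpace I x} {x₀ : M} {y : E} (hy : y ∈ (extChartAt I x₀).target)
    (hX : SmoothFieldAt X ((extChartAt I x₀).symm y))
    (hY : SmoothFieldAt Y ((extChartAt I x₀).symm y)) :
    fibreCoord x₀ _ (nijenhuis J X Y ((extChartAt I x₀).symm y)) =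
      nijenhuisModel (endRep x₀ J) y (fieldRep x₀ X y) (fieldRep x₀ Y y) := by
  have hJZ {Z : (x : M) → TangentSpace I x} (hZ : SmoothFieldAt Z ((extChartAt I x₀).symm y)) :
      SmoothFieldAt (fun x ↦ J x (Z x)) ((extChartAt I x₀).symm y) :=
    ContMDiffAt.clm_bundle_apply (hJ _) hZ
  have hrep (Z : (x : M) → TangentSpace I x) : fieldRep x₀ (fun x ↦ J x (Z x)) =ᶠ[nhds y]
      fun z ↦ endRep x₀ J z (fieldRep x₀ Z z) := by
    filter_upwards [target_mem_nhds hy] with z hz using fibreCoord_end hz J _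
  have hA : DifferentiableAt ℝ (endRep x₀ J) y :=
    (contDiffAt_endRep hy hJ).differentiableAt (by simp)
  have hd {Z : (x : M) → TangentSpace I x} (hZ : SmoothFieldAt Z ((extChartAt I x₀).symm y))
      (ξ : E) : fderiv ℝ (fun z ↦ endRep x₀ J z (fieldRep x₀ Z z)) y ξ =
        fderiv ℝ (endRep x₀ J) y ξ (fieldRep x₀ Z y) +
          endRep x₀ J y (fderiv ℝ (fieldRep x₀ Z) y ξ) := by
    have h := congrArg (fun l : E →L[ℝ] E ↦ l ξ) (hA.hasFDerivAt.clm_apply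
      (differentiableAt_fieldRep hy hZ.mdifferentiableAt).hasFDerivAt).fderiv
    refine h.trans ?_
    simp [add_comm]
  rw [nijenhuis, map_add, map_sub, map_sub, fibreCoord_end hy, fibreCoord_end hy,
    fibreCoord_end hy, fibreCoord_end hy,
    fibreCoord_mlieBracket hy (hJZ hX).mdifferentiableAt (hJZ hY).mdifferentiableAt,
    fibreCoord_mlieBracket hy (hJZ hX).mdifferentiableAt hY.mdifferentiableAt,
    fibreCoord_mlieBracket hy hX.mdifferentiableAt (hJZ hY).mdifferentiableAt,
    fibreCoord_mlieBracket hy hX.mdifferentiableAt hY.mdifferentiableAt,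
    Filter.EventuallyEq.lieBracket_vectorField_eq (hrep X) (hrep Y),
    Filter.EventuallyEq.lieBracket_vectorField_eq (hrep X) Filter.EventuallyEq.rfl,
    Filter.EventuallyEq.lieBracket_vectorField_eq Filter.EventuallyEq.rfl (hrep Y)]
  simp only [lieBracket_eq, hd hX, hd hY, map_add, map_sub, nijenhuisModel]
  abel

theorem isIntegrable_of_nijenhuisModel [CompleteSpace E] {J : EndField I M}
    (hJ : IsSmoothEndField J)
    (h : ∀ (x₀ : M) (ζ η : E), nijenhuisModel (endRep x₀ J) (extChartAt I x₀ x₀) ζ η = 0) :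
    IsIntegrable J := by
  intro x₀ X Y hX hY
  have hx := mem_extChartAt_target (I := I) x₀
  have h0 := extChartAt_to_inv (I := I) x₀
  have h1 := fibreCoord_nijenhuis hJ (X := X) (Y := Y) hx (by rwa [h0]) (by rwa [h0])
  rw [h, h0] at h1
  rw [← fibreCoordSymm_fibreCoord (mem_chart_source H x₀) (nijenhuis J X Y x₀), h1, map_zero]

end SmoothnessFromCharts

/-! ### The lifted metallic Riemannian structure on `TM` -/

section Lift

variable {E : Type*} [NormedAddCommGroup E] [NormedSpace ℝ E] [FiniteDimensional ℝ E]
  {H : Type*} [TopologicalSpace H] {I : ModelWithCorners ℝ E H}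
  {M : Type*} [TopologicalSpace M] [ChartedSpace H M] [IsManifold I ∞ M]
  {p q : ℝ} {J : EndField I M} {g : SmoothMetric I M} {cov : Connection I M}

theorem flat_sharp (g : SmoothMetric I M) (x : M) (α : Cotangent I x) :
    g.inner x (sharp g x α) = α :=
  (flat_isInvertible g x).self_apply_inverse α

theorem sharp_flat (g : SmoothMetric I M) (x : M) (v : TangentSpace I x) :
    sharp g x (flat g x v) = v :=
  (flat_isInvertible g x).inverse_apply_self v

/-- By symmetry of `J`, g(J♯α, w) = g(♯α, Jw) = α(Jw), so J♯α represents `J* α`. -/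
theorem sharp_dualEnd (h : IsMetallicRiemannian p q J g) (x : M) (α : Cotangent I x) :
    sharp g x (dualEnd J x α) = J x (sharp g x α) := by
  rw [← sharp_flat g x (J x (sharp g x α))]
  congr 1
  ext w
  change α (J x w) = g.inner x (J x (sharp g x α)) w
  rw [h.compatible, flat_sharp]

omit [FiniteDimensional ℝ E] in
theorem dualEnd_sq (h : IsMetallicRiemannian p q J g) (x : M) (α : Cotangent I x) :
    dualEnd J x (dualEnd J x α) = p • dualEnd J x α + q • α := by
  ext w
  change α (J x (J x w)) = p • α (J x w) + q • α w
  rw [h.metallic.sq, map_add, map_smul, map_smul]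

theorem liftMetallic_Psi (J : EndField I M) (g : SmoothMetric I M) (cov : Connection I M)
    (a : TangentBundle I M) (s : GenTangent I a.proj) :
    liftMetallic J g cov a (Psi g cov a s) = Psi g cov a (genMetallic J a.proj s) := by
  change Psi g cov a (genMetallic J a.proj ((Psi g cov a).inverse (Psi g cov a s))) = _
  rw [(Psi_isInvertible g cov a).inverse_apply_self]

theorem liftMetric_Psi (g : SmoothMetric I M) (cov : Connection I M)
    (a : TangentBundle I M) (s t : GenTangent I a.proj) :
    liftMetric g cov a (Psi g cov a s) (Psi g cov a t) = genMetric g a.proj s t := by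
  rw [liftMetric, (Psi_isInvertible g cov a).inverse_apply_self,
    (Psi_isInvertible g cov a).inverse_apply_self]

theorem exists_Psi_eq (g : SmoothMetric I M) (cov : Connection I M) (a : TangentBundle I M)
    (A : TangentSpace I.tangent a) : ∃ s : GenTangent I a.proj, Psi g cov a s = A :=
  ⟨_, (Psi_isInvertible g cov a).self_apply_inverse A⟩

theorem liftMetallic_sq (h : IsMetallicRiemannian p q J g) (a : TangentBundle I M)
    (A : TangentSpace I.tangent a) :
    liftMetallic J g cov a (liftMetallic J g cov a A) = p • liftMetallic J g cov a A + q • A := by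
  obtain ⟨s, rfl⟩ := exists_Psi_eq g cov a A
  have hs : genMetallic J a.proj (genMetallic J a.proj s) = p • genMetallic J a.proj s + q • s :=
    Prod.ext (h.metallic.sq _ _) (dualEnd_sq h _ _)
  rw [liftMetallic_Psi, liftMetallic_Psi, hs]
  exact ((Psi g cov a).map_add _ _).trans
    (congrArg₂ (· + ·) ((Psi g cov a).map_smul _ _) ((Psi g cov a).map_smul _ _))

theorem liftMetric_liftMetallic (h : IsMetallicRiemannian p q J g) (a : TangentBundle I M)
    (A B : TangentSpace I.tangent a) :
    liftMetric g cov a (liftMetallic J g cov a A) B =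
      liftMetric g cov a A (liftMetallic J g cov a B) := by
  obtain ⟨s, rfl⟩ := exists_Psi_eq g cov a A
  obtain ⟨t, rfl⟩ := exists_Psi_eq g cov a B
  rw [liftMetallic_Psi, liftMetallic_Psi, liftMetric_Psi, liftMetric_Psi]
  change g.inner _ (J _ s.1) t.1 + g.inner _ (sharp g _ (dualEnd J _ s.2)) (sharp g _ t.2) =
    g.inner _ s.1 (J _ t.1) + g.inner _ (sharp g _ s.2) (sharp g _ (dualEnd J _ t.2))
  rw [sharp_dualEnd h, sharp_dualEnd h, h.compatible, h.compatible]

variable [I.Boundaryless] {y : E}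

theorem fibreCoord_Psi (g : SmoothMetric I M) (cov : Connection I M) (a₀ : TangentBundle I M)
    (hy : y ∈ (extChartAt I a₀.proj).target) (u : TangentSpace I ((extChartAt I a₀.proj).symm y))
    (s : GenTangent I ((extChartAt I a₀.proj).symm y)) :
    fibreCoord (I := I.tangent) a₀ (⟨_, u⟩ : TangentBundle I M) (Psi g cov ⟨_, u⟩ s) =
      (fibreCoord a₀.proj _ s.1, fibreCoord a₀.proj _ (sharp g _ s.2) -
        christoffel a₀.proj cov y (fibreCoord a₀.proj _ s.1) (fibreCoord a₀.proj _ u)) := by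
  have h1 := fibreCoord_horizontal cov a₀ hy u s.1
  have h2 := fibreCoord_vertical a₀ ⟨_, u⟩ (mem_chart_source_of_mem_target hy) (sharp g _ s.2)
  have hadd (L : E × E →L[ℝ] E × E) {p q r s : E × E} (hp : L p = r) (hq : L q = s) :
      L (p + q) = r + s := by rw [map_add, hp, hq]
  refine (hadd _ h1 h2).trans ?_
  ext
  · simp
  · simp only [Prod.snd_add]
    abel

/-- Writing the vector as Ψ(s) reduces the claim to `sharp_dualEnd`; the Γ terms of the two sides
then match. -/
theorem fibreCoord_liftMetallic (h : IsMetallicRiemannian p q J g) (cov : Connection I M)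
    (a₀ : TangentBundle I M)
    (hy : y ∈ (extChartAt I a₀.proj).target) (u : TangentSpace I ((extChartAt I a₀.proj).symm y))
    (A : TangentSpace I.tangent (⟨_, u⟩ : TangentBundle I M)) :
    fibreCoord (I := I.tangent) a₀ (⟨_, u⟩ : TangentBundle I M) (liftMetallic J g cov ⟨_, u⟩ A) =
      liftModel (endRep a₀.proj J y) (christoffel a₀.proj cov y) (fibreCoord a₀.proj _ u)
        (fibreCoord (I := I.tangent) a₀ (⟨_, u⟩ : TangentBundle I M) A) := by
  obtain ⟨s, rfl⟩ := exists_Psi_eq g cov _ A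
  rw [liftMetallic_Psi, fibreCoord_Psi g cov a₀ hy, fibreCoord_Psi g cov a₀ hy, liftModel_apply]
  change (fibreCoord a₀.proj _ (J _ s.1), fibreCoord a₀.proj _ (sharp g _ (dualEnd J _ s.2)) -
    christoffel a₀.proj cov y (fibreCoord a₀.proj _ (J _ s.1)) _) = _
  rw [sharp_dualEnd h, fibreCoord_end hy, fibreCoord_end hy, map_sub]
  simp

theorem liftMetric_eq_liftMetricModel (g : SmoothMetric I M) (cov : Connection I M)
    (a₀ : TangentBundle I M)
    (hy : y ∈ (extChartAt I a₀.proj).target) (u : TangentSpace I ((extChartAt I a₀.proj).symm y))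
    (A B : TangentSpace I.tangent (⟨_, u⟩ : TangentBundle I M)) :
    liftMetric g cov ⟨_, u⟩ A B =
      liftMetricModel (metricRep a₀.proj g y) (christoffel a₀.proj cov y) (fibreCoord a₀.proj _ u)
        (fibreCoord (I := I.tangent) a₀ (⟨_, u⟩ : TangentBundle I M) A)
        (fibreCoord (I := I.tangent) a₀ (⟨_, u⟩ : TangentBundle I M) B) := by
  obtain ⟨s, rfl⟩ := exists_Psi_eq g cov _ A
  obtain ⟨t, rfl⟩ := exists_Psi_eq g cov _ B
  rw [liftMetric_Psi, fibreCoord_Psi g cov a₀ hy, fibreCoord_Psi g cov a₀ hy,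
    liftMetricModel_apply]
  change g.inner _ s.1 t.1 + g.inner _ (sharp g _ s.2) (sharp g _ t.2) = _
  rw [inner_eq_metricRep hy, inner_eq_metricRep hy]
  simp

variable (g cov) in
/-- The lifted metric as a field of continuous bilinear forms. -/
def liftBilin (a : TangentBundle I M) :
    TangentSpace I.tangent a →L[ℝ] TangentSpace I.tangent a →L[ℝ] ℝ :=
  let P : TangentSpace I.tangent a →L[ℝ] TangentSpace I a.proj :=
    ContinuousLinearMap.fst ℝ _ _ ∘L (Psi g cov a).inverse
  let Q : TangentSpace I.tangent a →L[ℝ] TangentSpace I a.proj :=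
    sharp g a.proj ∘L ContinuousLinearMap.snd ℝ _ _ ∘L (Psi g cov a).inverse
  ContinuousLinearMap.precomp ℝ P ∘L g.inner a.proj ∘L P +
    ContinuousLinearMap.precomp ℝ Q ∘L g.inner a.proj ∘L Q

omit [FiniteDimensional ℝ E] [I.Boundaryless] in
theorem liftBilin_apply (a : TangentBundle I M) (A B : TangentSpace I.tangent a) :
    liftBilin g cov a A B = liftMetric g cov a A B :=
  rfl

theorem endRep_liftMetallic (h : IsMetallicRiemannian p q J g) (cov : Connection I M)
    {a₀ : TangentBundle I M} {z : E × E} (hz : z ∈ (extChartAt I.tangent a₀).target) :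
    endRep a₀ (liftMetallic J g cov) z =
      liftModel (endRep a₀.proj J z.1) (christoffel a₀.proj cov z.1) z.2 := by
  have hy := mem_target_tangent hz
  have hx := mem_chart_source_of_mem_target hy
  have ha : (⟨(extChartAt I a₀.proj).symm z.1,
      fibreCoordSymm a₀.proj ((extChartAt I a₀.proj).symm z.1) z.2⟩ : TangentBundle I M) ∈
      (chartAt (ModelProd H E) a₀).source :=
    (TangentBundle.mem_chart_source_iff _ a₀).2 hx
  refine ContinuousLinearMap.ext fun ζ ↦ ?_
  rw [endRep, extChartAt_tangent_symm hz]
  refine (fibreCoord_liftMetallic h cov a₀ hy _ _).trans ?_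
  rw [fibreCoord_fibreCoordSymm hx]
  exact congrArg (liftModel (endRep a₀.proj J z.1) (christoffel a₀.proj cov z.1) z.2)
    (fibreCoord_fibreCoordSymm (I := I.tangent) ha ζ)

theorem bilinRep_liftBilin (g : SmoothMetric I M) (cov : Connection I M)
    {a₀ : TangentBundle I M} {z : E × E} (hz : z ∈ (extChartAt I.tangent a₀).target) :
    bilinRep a₀ (liftBilin g cov) z =
      liftMetricModel (metricRep a₀.proj g z.1) (christoffel a₀.proj cov z.1) z.2 := by
  have hy := mem_target_tangent hz
  have hx := mem_chart_source_of_mem_target hy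
  have ha : (⟨(extChartAt I a₀.proj).symm z.1,
      fibreCoordSymm a₀.proj ((extChartAt I a₀.proj).symm z.1) z.2⟩ : TangentBundle I M) ∈
      (chartAt (ModelProd H E) a₀).source :=
    (TangentBundle.mem_chart_source_iff _ a₀).2 hx
  refine ContinuousLinearMap.ext fun ζ ↦ ContinuousLinearMap.ext fun η ↦ ?_
  rw [bilinRep, extChartAt_tangent_symm hz]
  refine (liftMetric_eq_liftMetricModel g cov a₀ hy _ _ _).trans ?_
  rw [fibreCoord_fibreCoordSymm hx]
  exact congrArg₂
    (fun A B ↦ liftMetricModel (metricRep a₀.proj g z.1) (christoffel a₀.proj cov z.1) z.2 A B)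
    (fibreCoord_fibreCoordSymm (I := I.tangent) ha ζ)
    (fibreCoord_fibreCoordSymm (I := I.tangent) ha η)

omit [I.Boundaryless] in
-- In terms of Ψ the form is g(X, X) + g(♯α, ♯α), and injectivity of `♯_g` makes one summand
-- positive unless both X and α vanish.
theorem liftBilin_pos (g : SmoothMetric I M) (cov : Connection I M) (a : TangentBundle I M)
    (A : TangentSpace I.tangent a) (hA : A ≠ 0) : 0 < liftBilin g cov a A A := by
  obtain ⟨s, rfl⟩ := exists_Psi_eq g cov a A
  rw [liftBilin_apply, liftMetric_Psi]
  have hnn (v : TangentSpace I a.proj) : 0 ≤ g.inner a.proj v v := by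
    rcases eq_or_ne v 0 with rfl | hv
    · simp
    · exact (g.pos _ v hv).le
  by_cases h1 : s.1 = 0
  · have h2 : sharp g a.proj s.2 ≠ 0 := by
      intro h2
      apply hA
      have h3 : s.2 = 0 := by rw [← flat_sharp g a.proj s.2, h2, map_zero]
      rw [show s = 0 from Prod.ext h1 h3, map_zero]
    exact add_pos_of_nonneg_of_pos (hnn _) (g.pos _ _ h2)
  · exact add_pos_of_pos_of_nonneg (g.pos _ _ h1) (hnn _)

omit [FiniteDimensional ℝ E] [I.Boundaryless] in
theorem liftBilin_symm (g : SmoothMetric I M) (cov : Connection I M) (a : TangentBundle I M)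
    (A B : TangentSpace I.tangent a) : liftBilin g cov a A B = liftBilin g cov a B A := by
  rw [liftBilin_apply, liftBilin_apply, liftMetric, liftMetric, genMetric, genMetric, g.symm,
    g.symm a.proj (sharp g a.proj _)]

theorem contDiffAt_endRep_liftMetallic (h : IsMetallicRiemannian p q J g)
    (hcov : IsLeviCivita g cov) {a₀ : TangentBundle I M} {z : E × E}
    (hz : z ∈ (extChartAt I.tangent a₀).target) :
    ContDiffAt ℝ ∞ (endRep a₀ (liftMetallic J g cov)) z := by
  have hy := mem_target_tangent hz
  refine (contDiffAt_liftModel (contDiffAt_endRep hy h.metallic.smooth)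
    (contDiffAt_christoffel hcov hy)).congr_of_eventuallyEq ?_
  filter_upwards [target_mem_nhds hz] with w hw using endRep_liftMetallic h cov hw

theorem contDiffAt_bilinRep_liftBilin (hcov : IsLeviCivita g cov) {a₀ : TangentBundle I M}
    {z : E × E} (hz : z ∈ (extChartAt I.tangent a₀).target) :
    ContDiffAt ℝ ∞ (bilinRep a₀ (liftBilin g cov)) z := by
  have hy := mem_target_tangent hz
  refine (contDiffAt_liftMetricModel (contDiffAt_metricRep hy g)
    (contDiffAt_christoffel hcov hy)).congr_of_eventuallyEq ?_
  filter_upwards [target_mem_nhds hz] with w hw using bilinRep_liftBilin g cov hw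

/-- The lifted metric on the tangent bundle, as a smooth Riemannian metric. -/
def liftSmoothMetric (hcov : IsLeviCivita g cov) :
    SmoothMetric I.tangent (TangentBundle I M) where
  inner := liftBilin g cov
  symm := liftBilin_symm g cov
  pos := liftBilin_pos g cov
  isVonNBounded a := isVonNBounded_of_pos (E := E × E) (b := liftBilin g cov a)
    (liftBilin_pos g cov a)
  contMDiff := contMDiff_of_bilinRep fun _ ↦
    contDiffAt_bilinRep_liftBilin hcov (mem_extChartAt_target _)

theorem isSmoothEndField_liftMetallic (h : IsMetallicRiemannian p q J g)
    (hcov : IsLeviCivita g cov) : IsSmoothEndField (liftMetallic J g cov) :=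
  isSmoothEndField_of_endRep fun _ ↦
    contDiffAt_endRep_liftMetallic h hcov (mem_extChartAt_target _)

theorem isIntegrable_liftMetallic (h : IsFlatLocallyMetallic p q J g cov) :
    IsIntegrable (liftMetallic J g cov) := by
  have : CompleteSpace E := FiniteDimensional.complete ℝ E
  have hJ := h.metallicRiemannian.metallic.smooth
  refine isIntegrable_of_nijenhuisModel
    (isSmoothEndField_liftMetallic h.metallicRiemannian h.leviCivita) fun a₀ ζ η ↦ ?_
  have hz := mem_extChartAt_target (I := I.tangent) a₀
  have hy := mem_target_tangent hz
  have he : endRep a₀ (liftMetallic J g cov) =ᶠ[nhds (extChartAt I.tangent a₀ a₀)]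
      fun z : E × E ↦ liftModel (endRep a₀.proj J z.1) (christoffel a₀.proj cov z.1) z.2 := by
    filter_upwards [target_mem_nhds hz] with w hw
      using endRep_liftMetallic h.metallicRiemannian cov hw
  rw [nijenhuisModel_congr he]
  exact nijenhuisModel_liftModel (contDiffAt_endRep hy hJ)
    (contDiffAt_christoffel h.leviCivita hy) (christoffel_symm cov h.leviCivita.1 hy)
    (fderiv_endRep hJ h.parallel hy) (curvature_christoffel h.leviCivita h.flat hy) _ ζ η

end Lift

end MetallicGeometry

end

theorem mainTheorem10 {E : Type*} [NormedAddCommGroup E] [NormedSpace ℝ E] [FiniteDimensional ℝ E]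
    {M : Type*} [TopologicalSpace M] [ChartedSpace E M] [IsManifold 𝓘(ℝ, E) ∞ M]
    (p q : ℝ) (J : EndField 𝓘(ℝ, E) M) (g : SmoothMetric 𝓘(ℝ, E) M) (cov : Connection 𝓘(ℝ, E) M)
    (h : IsFlatLocallyMetallic p q J g cov) :
    ∃ G : SmoothMetric (𝓘(ℝ, E)).tangent (TangentBundle 𝓘(ℝ, E) M),
      (∀ (a : TangentBundle 𝓘(ℝ, E) M) (A B : TangentSpace (𝓘(ℝ, E)).tangent a),
        G.inner a A B = liftMetric g cov a A B) ∧
      IsMetallicRiemannian p q (liftMetallic J g cov) G ∧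
      IsIntegrable (liftMetallic J g cov) := by
  exact ⟨liftSmoothMetric h.leviCivita, liftBilin_apply,
    ⟨⟨isSmoothEndField_liftMetallic h.metallicRiemannian h.leviCivita,
      liftMetallic_sq h.metallicRiemannian⟩, liftMetric_liftMetallic h.metallicRiemannian⟩,
    isIntegrable_liftMetallic h⟩
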